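/- Let $\mu$ be a regular cardinal and let $\mathbf{K}$ be a $\mu$-AEC, regarded as a category whose morphisms are the $\mathbf{K}$-embeddings. Definitions. An amalgam of a span $(f_1 : M_0\to M_1, f_2 : M_0\to M_2)$ is a cospan $(g_1 : M_1\to N, g_2 : M_2\to N)$ with $g_1f_1=g_2f_2$. Two amalgams $(g_1^a,g_2^a)$, $(g_1^b,g_2^b)$ of the same span are related by $\sim^*$ if there are morphisms $g^a:N^a\to N_*$, $g^b:N^b\to N_*$ with $g^ag^a_\ell=g^bg^b_\ell$ for $\ell=1,2$; $\sim$ is the transitive closure of $\sim^*$. An independence relation $\perp$ is a class of commutative squares $(f_1,f_2,g_1,g_2)$ closed under $\sim$. Its dual is $\perp^d(f_1,f_2,g_1,g_2):\Leftrightarrow\ \perp(f_2,f_1,g_2,g_1)$. The relation $\perp$ is * invariant if it is closed under isomorphism of squares, and symmetric if $\perp=\perp^d$; * right transitive if independent squares are closed under horizontal composition, that is, $\perp(f_{01},f_{02},f_{13},f_{23})$ and $\perp(f_{23},f_{24},f_{35},f_{45})$ imply $\perp(f_{01},f_{24}f_{02},f_{35}f_{13},f_{45})$; left transitive if $\perp^d$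 is right transitive; transitive if both. It has existence if every span has an amalgam giving an independent square, and uniqueness if any two independent amalgams of the same span are $\sim$-equivalent. For $N_0\le_{\mathbf K} N$ and sets $A,B\subseteq UN$, write $\overline{\perp}(N_0,A,B,N)$ if there are $M_1,M_2,M_3\in\mathbf{K}$ with $N_0\le_{\mathbf K} M_\ell\le_{\mathbf K} M_3$ for $\ell=1,2$, $N\le_{\mathbf K} M_3$, $A\subseteq UM_1$, $B\subseteq UM_2$, such that the square of inclusions of $N_0,M_1,M_2,M_3$ is independent. The relation $\perp$ has right local character if for each cardinal $\alpha$ there is a cardinal $\lambda$ such that for all $M\le_{\mathbf K}N$ and every $\alpha$-sequence $\bar a$ in $N$ there is $M_0\le_{\mathbf K}M$ with $|UM_0|\le\lambda$ and $\overline{\perp}(M_0,\operatorname{ran}\bar a,UM,N)$ (that is, the Galois type of $\bar a$ over $M$ in $N$ does not fork over $M_0$). If $\perp$ is right transitive with existence, $\mathcal{K}_{\mathrm{NF}}$ is the category whose objects are the morphisms of $\mathbf{K}$ and whose morphisms from $f:M_1\to M_2$ to $g:N_1\to N_2$ are the pairs $(h_1:M_1\to N_1,h_2:M_2\to N_2)$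 with $\perp(f,h_1,h_2,g)$. The relation $\perp$ is accessible if this category is accessible for both $\perp$ and $\perp^d$. It is stable if it is symmetric, transitive, accessible, and has existence and uniqueness. $\mathbf{K}$ has chain bounds if every nonempty increasing chain $\langle M_i:i<\delta\rangle$ in $\mathbf{K}$ ($\delta$ an ordinal) has an upper bound in $\mathbf{K}$. The Galois types $\operatorname{gtp}(\bar a/\emptyset;M)$ and $\operatorname{gtp}(\bar b/\emptyset;N)$ are equal when $(\bar a,M)$ and $(\bar b,N)$ are related by the transitive closure of the relation "there are $\mathbf{K}$-embeddings $g,h$ of $M$, $N$ into a common member of $\mathbf{K}$ with $g(\bar a)=h(\bar b)$". $\mathbf{K}$ has the order property if there is $\alpha$ such that for every $\theta$ there are $M\in\mathbf{K}$ and a sequence $\langle\bar a_i:i<\theta\rangle$ of $\alpha$-sequences in $M$ such that for all $i_0<j_0<\theta$ and $i_1<j_1<\theta$, $\operatorname{gtp}(\bar a_{i_0}\bar a_{j_0}/\emptyset;M)\ne\operatorname{gtp}(\bar a_{j_1}\bar a_{i_1}/\emptyset;M)$. Theorem. 1. Let $\perp$ be an invariant, transitive independence relation on $\mathbf{K}$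 with existence, uniqueness and right local character. If $\mathbf{K}$ has chain bounds, or if $\perp$ is symmetric, then $\mathbf{K}$ does not have the order property. 2. If there is a stable independence relation on $\mathbf{K}$, then $\mathbf{K}$ does not have the order property. -/

import Mathlib

universe w v u

namespace MuAEC

open CategoryTheory

/-! ### Independence relations in an arbitrary category -/

section Independence

variable {C : Type u} [Category.{v} C]

/-- An amalgam of a span `(f₁, f₂)`: a cospan completing it to a commutative square. -/
structure Amalgam {M₀ M₁ M₂ : C} (f₁ : M₀ ⟶ M₁) (f₂ : M₀ ⟶ M₂) where
  pt : C
  inl : M₁ ⟶ pt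
  inr : M₂ ⟶ pt
  comm : f₁ ≫ inl = f₂ ≫ inr

/-- The relation `∼*`: two amalgams of the same span map to a common amalgam. -/
def Amalgam.EquivStar {M₀ M₁ M₂ : C} {f₁ : M₀ ⟶ M₁} {f₂ : M₀ ⟶ M₂}
    (a b : Amalgam f₁ f₂) : Prop :=
  ∃ (N : C) (ga : a.pt ⟶ N) (gb : b.pt ⟶ N),
    a.inl ≫ ga = b.inl ≫ gb ∧ a.inr ≫ ga = b.inr ≫ gb

/-- Equivalence of amalgams: the transitive closure `∼` of `∼*`. -/
def Amalgam.Equiv {M₀ M₁ M₂ : C} {f₁ : M₀ ⟶ M₁} {f₂ : M₀ ⟶ M₂} :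
    Amalgam f₁ f₂ → Amalgam f₁ f₂ → Prop :=
  Relation.TransGen Amalgam.EquivStar

variable (C) in
/-- An independence relation on a category: a collection of amalgamation diagrams
(commutative squares) closed under equivalence of amalgams. In `rel f₁ f₂ g₁ g₂` the maps are
`f₁ : M₀ ⟶ M₁`, `f₂ : M₀ ⟶ M₂`, `g₁ : M₁ ⟶ M₃`, `g₂ : M₂ ⟶ M₃`. -/
structure IndepRel where
  rel : ∀ {M₀ M₁ M₂ M₃ : C}, (M₀ ⟶ M₁) → (M₀ ⟶ M₂) → (M₁ ⟶ M₃) → (M₂ ⟶ M₃) → Prop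
  comm : ∀ {M₀ M₁ M₂ M₃ : C} {f₁ : M₀ ⟶ M₁} {f₂ : M₀ ⟶ M₂} {g₁ : M₁ ⟶ M₃} {g₂ : M₂ ⟶ M₃},
    rel f₁ f₂ g₁ g₂ → f₁ ≫ g₁ = f₂ ≫ g₂
  closed : ∀ {M₀ M₁ M₂ : C} {f₁ : M₀ ⟶ M₁} {f₂ : M₀ ⟶ M₂} (a b : Amalgam f₁ f₂),
    a.Equiv b → rel f₁ f₂ a.inl a.inr → rel f₁ f₂ b.inl b.inr

/-- The same amalgam, with the two sides of the span exchanged. -/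
def Amalgam.swap {M₀ M₁ M₂ : C} {f₁ : M₀ ⟶ M₁} {f₂ : M₀ ⟶ M₂}
    (a : Amalgam f₁ f₂) : Amalgam f₂ f₁ :=
  ⟨a.pt, a.inr, a.inl, a.comm.symm⟩

theorem Amalgam.Equiv.swap {M₀ M₁ M₂ : C} {f₁ : M₀ ⟶ M₁} {f₂ : M₀ ⟶ M₂}
    {a b : Amalgam f₁ f₂} (h : a.Equiv b) : a.swap.Equiv b.swap := by
  refine Relation.TransGen.lift (Amalgam.swap (f₁ := f₁) (f₂ := f₂)) ?_ _ _ h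
  rintro x y ⟨N, ga, gb, h₁, h₂⟩
  exact ⟨N, ga, gb, h₂, h₁⟩

namespace IndepRel

/-- The dual relation, exchanging the left and the right side. -/
def dual (R : IndepRel C) : IndepRel C where
  rel f₁ f₂ g₁ g₂ := R.rel f₂ f₁ g₂ g₁
  comm h := (R.comm h).symm
  closed a b hab h := R.closed a.swap b.swap hab.swap h

def Symmetric (R : IndepRel C) : Prop := R = R.dual

/-- Invariance under isomorphisms of amalgamation diagrams. -/
def Invariant (R : IndepRel C) : Prop :=
  ∀ {M₀ M₁ M₂ M₃ N₀ N₁ N₂ N₃ : C}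
    (f₁ : M₀ ⟶ M₁) (f₂ : M₀ ⟶ M₂) (g₁ : M₁ ⟶ M₃) (g₂ : M₂ ⟶ M₃)
    (f₁' : N₀ ⟶ N₁) (f₂' : N₀ ⟶ N₂) (g₁' : N₁ ⟶ N₃) (g₂' : N₂ ⟶ N₃)
    (e₀ : M₀ ≅ N₀) (e₁ : M₁ ≅ N₁) (e₂ : M₂ ≅ N₂) (e₃ : M₃ ≅ N₃),
    f₁ ≫ e₁.hom = e₀.hom ≫ f₁' → f₂ ≫ e₂.hom = e₀.hom ≫ f₂' →
    g₁ ≫ e₃.hom = e₁.hom ≫ g₁' → g₂ ≫ e₃.hom = e₂.hom ≫ g₂' →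
    R.rel f₁ f₂ g₁ g₂ → R.rel f₁' f₂' g₁' g₂'

/-- Every span has an independent amalgam. -/
def Existence (R : IndepRel C) : Prop :=
  ∀ {M₀ M₁ M₂ : C} (f₁ : M₀ ⟶ M₁) (f₂ : M₀ ⟶ M₂),
    ∃ (M₃ : C) (g₁ : M₁ ⟶ M₃) (g₂ : M₂ ⟶ M₃), R.rel f₁ f₂ g₁ g₂

/-- Any two independent amalgams of the same span are equivalent. -/
def Uniqueness (R : IndepRel C) : Prop :=
  ∀ {M₀ M₁ M₂ : C} {f₁ : M₀ ⟶ M₁} {f₂ : M₀ ⟶ M₂} (a b : Amalgam f₁ f₂),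
    R.rel f₁ f₂ a.inl a.inr → R.rel f₁ f₂ b.inl b.inr → a.Equiv b

def RightTransitive (R : IndepRel C) : Prop :=
  ∀ {M₀ M₁ M₂ M₃ M₄ M₅ : C} (f₀₁ : M₀ ⟶ M₁) (f₀₂ : M₀ ⟶ M₂) (f₁₃ : M₁ ⟶ M₃) (f₂₃ : M₂ ⟶ M₃)
    (f₂₄ : M₂ ⟶ M₄) (f₃₅ : M₃ ⟶ M₅) (f₄₅ : M₄ ⟶ M₅),
    R.rel f₀₁ f₀₂ f₁₃ f₂₃ → R.rel f₂₃ f₂₄ f₃₅ f₄₅ →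
    R.rel f₀₁ (f₀₂ ≫ f₂₄) (f₁₃ ≫ f₃₅) f₄₅

def LeftTransitive (R : IndepRel C) : Prop := R.dual.RightTransitive

def Transitive (R : IndepRel C) : Prop := R.LeftTransitive ∧ R.RightTransitive

/-- The class of commutative squares, seen as morphisms of the arrow category from `f` to `g`,
that are independent: `f : M₁ ⟶ M₂` is on the left, `M₁ ⟶ N₁` at the bottom, `M₂ ⟶ N₂` on top
and `g : N₁ ⟶ N₂` on the right. -/
def nf (R : IndepRel C) : MorphismProperty (Arrow C) :=
  fun f g h => R.rel f.hom h.left h.right g.hom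

/-- With right transitivity and existence, independent squares contain the identities and are
closed under (horizontal) composition. -/
theorem nf_isMultiplicative (R : IndepRel C) (hT : R.RightTransitive) (hE : R.Existence) :
    R.nf.IsMultiplicative where
  id_mem f := by
    obtain ⟨N, h₁, h₂, h⟩ := hE f.hom (𝟙 f.left)
    have hc := R.comm h
    exact R.closed ⟨N, h₁, h₂, hc⟩ ⟨f.right, 𝟙 _, f.hom, by simp⟩
      (Relation.TransGen.single ⟨N, 𝟙 N, h₁, by simp, by simpa using hc.symm⟩) h
  comp_mem f g hf hg := hT _ _ _ _ _ _ _ hf hg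

/-- Right accessibility: the relation is right transitive (with existence) and the category of
independent squares, i.e. the category with objects the morphisms of `C` and with morphisms the
independent squares, is accessible. Smallness refers to the universe `w`. -/
def RightAccessible (R : IndepRel C) : Prop :=
  ∃ (hT : R.RightTransitive) (hE : R.Existence),
    haveI := R.nf_isMultiplicative hT hE
    IsAccessibleCategory.{w} (WideSubcategory R.nf)

def LeftAccessible (R : IndepRel C) : Prop := RightAccessible.{w} R.dual

def Accessible (R : IndepRel C) : Prop := LeftAccessible.{w} R ∧ RightAccessible.{w} R

/-- Stable independence relations. -/
structure Stable (R : IndepRel C) : Prop where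
  symmetric : R.Symmetric
  transitive : R.Transitive
  accessible : Accessible.{w} R
  existence : R.Existence
  uniqueness : R.Uniqueness

end IndepRel

end Independence

/-! ### Infinitary vocabularies, structures and embeddings -/

/-- A (possibly infinitary) vocabulary. The arity of a symbol is given by an index type. -/
structure Vocabulary where
  Func : Type u
  Rel : Type u
  funcArity : Func → Type u
  relArity : Rel → Type u

/-- All arities are smaller than `μ`. -/
def Vocabulary.IsAry (τ : Vocabulary.{u}) (μ : Cardinal.{u}) : Prop :=
  (∀ f, Cardinal.mk (τ.funcArity f) < μ) ∧ ∀ r, Cardinal.mk (τ.relArity r) < μ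

/-- The number of symbols. -/
def Vocabulary.card (τ : Vocabulary.{u}) : Cardinal.{u} :=
  Cardinal.mk τ.Func + Cardinal.mk τ.Rel

structure Str (τ : Vocabulary.{u}) where
  carrier : Type u
  func : ∀ f : τ.Func, (τ.funcArity f → carrier) → carrier
  rel : ∀ r : τ.Rel, (τ.relArity r → carrier) → Prop

instance (τ : Vocabulary.{u}) : CoeSort (Str τ) (Type u) := ⟨Str.carrier⟩

/-- Embeddings of `τ`-structures, that is, isomorphisms onto a substructure. -/
@[ext]
structure Emb {τ : Vocabulary.{u}} (M N : Str τ) where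
  toFun : M → N
  injective : Function.Injective toFun
  map_func : ∀ (f : τ.Func) (x : τ.funcArity f → M),
    toFun (M.func f x) = N.func f (toFun ∘ x)
  map_rel : ∀ (r : τ.Rel) (x : τ.relArity r → M), N.rel r (toFun ∘ x) ↔ M.rel r x

namespace Emb

variable {τ : Vocabulary.{u}} {M N P : Str τ}

def id (M : Str τ) : Emb M M := ⟨_root_.id, fun _ _ h => h, fun _ _ => rfl, fun _ _ => Iff.rfl⟩

/-- `g.comp f` is `f` followed by `g`. -/
def comp (g : Emb N P) (f : Emb M N) : Emb M P where
  toFun := g.toFun ∘ f.toFun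
  injective := g.injective.comp f.injective
  map_func F x := by
    simp only [Function.comp_apply, f.map_func, g.map_func]
    rfl
  map_rel r x := (g.map_rel r (f.toFun ∘ x)).trans (f.map_rel r x)

end Emb

/-! ### Abstract classes and `μ`-AECs -/

/-- An abstract class `(K, ≤)` in the vocabulary `τ`, presented through its `K`-embeddings.
`mem M` says `M ∈ K`; for an embedding `f : M → N`, `strong f` says that `M, N ∈ K` and
`f[M] ≤ N`. (For `M` a substructure of `N`, `M ≤ N` is strongness of the inclusion.)
`iso` expresses that `K` and `≤` are closed under isomorphism and that `≤` is reflexive,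
`comp` (together with `iso`) that `≤` is transitive and closed under isomorphism. Antisymmetry
is automatic since `≤` refines the substructure relation. -/
structure AbstractClass (τ : Vocabulary.{u}) where
  mem : Str τ → Prop
  strong : ∀ {M N : Str τ}, Emb M N → Prop
  mem_left : ∀ {M N : Str τ} (f : Emb M N), strong f → mem M
  mem_right : ∀ {M N : Str τ} (f : Emb M N), strong f → mem N
  iso : ∀ {M N : Str τ} (f : Emb M N), Function.Surjective f.toFun → mem M → strong f
  comp : ∀ {M N P : Str τ} (f : Emb M N) (g : Emb N P), strong f → strong g → strong (g.comp f)

namespace AbstractClass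

variable {τ : Vocabulary.{u}}

/-- `K` is a `μ`-abstract elementary class. -/
structure IsMuAEC (K : AbstractClass τ) (μ : Cardinal.{u}) : Prop where
  regular : μ.IsRegular
  ary : τ.IsAry μ
  /-- If `M₀ ⊆ M₁ ≤ M₂` and `M₀ ≤ M₂` then `M₀ ≤ M₁`. -/
  coherence : ∀ {M₀ M₁ M₂ : Str τ} (f : Emb M₀ M₁) (g : Emb M₁ M₂),
    K.strong g → K.strong (g.comp f) → K.strong f
  /-- The chain axioms. Let `(M i)` be a `μ`-directed system and let the structure `U` be its
  union: the `M i` embed in `U` through `c i`, they cover `U`, and for `i ≤ j` the inclusion of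
  `M i` in `M j` (as substructures of `U`) is strong. Then `U ∈ K`, `M i ≤ U` for all `i`, and
  `U ≤ N` whenever `M i ≤ N` for all `i`. -/
  chain : ∀ (I : Type u) [PartialOrder I],
    (∀ s : Set I, Cardinal.mk s < μ → ∃ b, ∀ i ∈ s, i ≤ b) →
    ∀ (M : I → Str τ) (U : Str τ) (c : ∀ i, Emb (M i) U),
    (∀ i j, i ≤ j → ∃ e : Emb (M i) (M j), K.strong e ∧ (c j).comp e = c i) →
    (∀ x : U, ∃ i, x ∈ Set.range (c i).toFun) →
    K.mem U ∧ (∀ i, K.strong (c i)) ∧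
      ∀ (N : Str τ) (f : Emb U N), (∀ i, K.strong (f.comp (c i))) → K.strong f
  /-- The Löwenheim–Skolem–Tarski axiom; `Cardinal.powerlt a μ` is `a^{<μ}`. -/
  lst : ∃ l : Cardinal.{u}, Cardinal.powerlt l μ = l ∧ τ.card + μ ≤ l ∧
    ∀ M : Str τ, K.mem M → ∀ A : Set M, ∃ (M₀ : Str τ) (f : Emb M₀ M), K.strong f ∧
      A ⊆ Set.range f.toFun ∧ Cardinal.mk M₀ ≤ Cardinal.powerlt (Cardinal.mk A) μ + l

/-- The members of `K`. -/
structure Model (K : AbstractClass τ) where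
  str : Str τ
  mem : K.mem str

instance (K : AbstractClass τ) : CoeSort K.Model (Type u) := ⟨fun M => M.str.carrier⟩

/-- `K`-embeddings. -/
@[ext]
structure Hom (K : AbstractClass τ) (M N : K.Model) where
  emb : Emb M.str N.str
  strong : K.strong emb

/-- `K` as a category, with the `K`-embeddings as morphisms. -/
instance (K : AbstractClass τ) : Category.{u} K.Model where
  Hom M N := K.Hom M N
  id M := ⟨Emb.id M.str, K.iso _ Function.surjective_id M.mem⟩
  comp f g := ⟨g.emb.comp f.emb, K.comp _ _ f.strong g.strong⟩

/-- The function underlying a `K`-embedding. -/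
def fn {K : AbstractClass τ} {M N : K.Model} (f : M ⟶ N) : M → N := (Hom.emb f).toFun

/-- `K` has chain bounds: every (nonempty) chain of `K`-embeddings indexed by a well-order has an
upper bound in `K`. -/
def HasChainBounds (K : AbstractClass τ) : Prop :=
  ∀ (I : Type u) [LinearOrder I] [WellFoundedLT I] [Nonempty I] (F : I ⥤ K.Model),
    Nonempty (Limits.Cocone F)

/-! ### Galois types over the empty set and the order property -/

/-- `(a, M)` and `(b, N)` are atomically equivalent over the empty set: some `K`-embeddings of
`M` and `N` in a common model send `a` and `b` to the same sequence. -/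
def AtomicEq (K : AbstractClass τ) (X : Type u) (p q : Σ M : K.Model, X → M) : Prop :=
  ∃ (N : K.Model) (g : p.1 ⟶ N) (h : q.1 ⟶ N), ∀ x, fn g (p.2 x) = fn h (q.2 x)

/-- Galois types over the empty set of sequences indexed by `X`: classes for the equivalence
relation generated by `AtomicEq` (which is its transitive closure, as `AtomicEq` is reflexive and
symmetric). -/
def GaloisType (K : AbstractClass τ) (X : Type u) : Type (u + 1) := Quot (K.AtomicEq X)

/-- The Galois type `gtp(a/∅; M)`. -/
def gtp (K : AbstractClass τ) {X : Type u} (M : K.Model) (a : X → M) : K.GaloisType X :=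
  Quot.mk _ ⟨M, a⟩

/-- The `α`-order property of length `θ`. Sequences of length `α` are given by functions on an
index type `α`; `Sum.elim a b` is the concatenation of `a` and `b`. -/
def OrderPropertyOfLength (K : AbstractClass τ) (α : Type u) (θ : Ordinal.{u}) : Prop :=
  ∃ (M : K.Model) (a : Set.Iio θ → α → M), ∀ i₀ j₀ i₁ j₁ : Set.Iio θ, i₀ < j₀ → i₁ < j₁ →
    K.gtp M (Sum.elim (a i₀) (a j₀)) ≠ K.gtp M (Sum.elim (a j₁) (a i₁))

def OrderProperty (K : AbstractClass τ) : Prop :=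
  ∃ α : Type u, ∀ θ : Ordinal.{u}, K.OrderPropertyOfLength α θ

/-! ### Nonforking of types and local character -/

variable {K : AbstractClass τ}

/-- The closure of the independence relation to sets. Here `M₀ ≤ N₃` through `i`, and `A`, `B`
are subsets of `N₃`; the relation holds if there are `M₁, M₂ ≤ M₃` and an extension `N₃ ≤ M₃`
(through `h`) such that `A ⊆ M₁`, `B ⊆ M₂` and `M₁`, `M₂` are independent over `M₀` in `M₃`. -/
def NfCl (R : IndepRel K.Model) {M₀ N₃ : K.Model} (i : M₀ ⟶ N₃) (A B : Set N₃) : Prop :=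
  ∃ (M₁ M₂ M₃ : K.Model) (f₁ : M₀ ⟶ M₁) (f₂ : M₀ ⟶ M₂) (g₁ : M₁ ⟶ M₃) (g₂ : M₂ ⟶ M₃)
    (h : N₃ ⟶ M₃), R.rel f₁ f₂ g₁ g₂ ∧ f₁ ≫ g₁ = i ≫ h ∧
      fn h '' A ⊆ Set.range (fn g₁) ∧ fn h '' B ⊆ Set.range (fn g₂)

/-- Right local character: for each length `α` there is a cardinal `l` such that for all `M ≤ N`
(through `i`) and every sequence `a` in `N` indexed by `α`, the type of `a` over `M` in `N` does
not fork over some `M₀ ≤ M` (through `j`) of cardinality at most `l`. -/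
def RightLocalCharacter (R : IndepRel K.Model) : Prop :=
  ∀ α : Type u, ∃ l : Cardinal.{u}, ∀ (M N : K.Model) (i : M ⟶ N) (a : α → N),
    ∃ (M₀ : K.Model) (j : M₀ ⟶ M), Cardinal.mk M₀ ≤ l ∧
      NfCl R (j ≫ i) (Set.range a) (Set.range (fn i))

end AbstractClass

end MuAEC

/-! Assume right local character and the order property. A long sequence witnessing the latter is
reflected into a small model N: for every late index j, the type of a_j over N does not fork over
some M₀ ≤ N, and N contains some a_{j'} with j' < j and the same type over M₀ (`exists_nonforking`).
So a_j on the left and a_{j'} on the right form an independent pair of realizations of one type over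
M₀, and by the order property the reversed pair has another Galois type (`exists_asymmetric`). By
uniqueness all independent pairs of copies of S over M₀ have the same type (`gtp_pair_eq`), so
symmetry gives a contradiction at once.

With chain bounds, the asymmetric pair is iterated to a long increasing chain of stages, the j-th
copy a_j being independent, on the right, from every earlier stage (`exists_independent_seq`).
Reflecting this new sequence yields j' < j and M₁ ≥ M₀ over which a_j and a_{j'} have the same type
and are independent with a_j on the left; by construction they are also independent with a_j on the
right. Uniqueness over M₁ identifies the types of the two orderings, which are those of the
asymmetric pair and its reversal.

For a stable relation, right local character comes from accessibility
(`rightLocalCharacter_of_rightAccessible`): an arrow M → N is a directed colimit, in the category of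
independent squares, of arrows from a fixed small set; colimits of small subdiagrams have small
domains, and one of them captures the given sequence. -/

namespace MuAEC

open CategoryTheory

/-! ### Formal calculus of independent squares -/

namespace Amalgam

variable {C : Type u} [Category.{v} C]

/-- An amalgam of `(f₁, f₂ ≫ k)`, seen as an amalgam of `(f₁, f₂)`. -/
def restrictRight {M₀ M₁ M₂ M₂' : C} {f₁ : M₀ ⟶ M₁} {f₂ : M₀ ⟶ M₂} {k : M₂ ⟶ M₂'}
    (a : Amalgam f₁ (f₂ ≫ k)) : Amalgam f₁ f₂ :=
  ⟨a.pt, a.inl, k ≫ a.inr, by simpa using a.comm⟩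

theorem Equiv.restrictRight {M₀ M₁ M₂ M₂' : C} {f₁ : M₀ ⟶ M₁} {f₂ : M₀ ⟶ M₂} {k : M₂ ⟶ M₂'}
    {a b : Amalgam f₁ (f₂ ≫ k)} (h : a.Equiv b) : a.restrictRight.Equiv b.restrictRight := by
  refine Relation.TransGen.lift (Amalgam.restrictRight (k := k)) ?_ _ _ h
  rintro x y ⟨N, ga, gb, h₁, h₂⟩
  exact ⟨N, ga, gb, h₁, by simp [Amalgam.restrictRight, h₂]⟩

end Amalgam

namespace IndepRel

variable {C : Type u} [Category.{v} C] {R : IndepRel C}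

theorem rel_comp {M₀ M₁ M₂ M₃ N : C} {f₁ : M₀ ⟶ M₁} {f₂ : M₀ ⟶ M₂} {g₁ : M₁ ⟶ M₃} {g₂ : M₂ ⟶ M₃}
    (h : R.rel f₁ f₂ g₁ g₂) (k : M₃ ⟶ N) : R.rel f₁ f₂ (g₁ ≫ k) (g₂ ≫ k) :=
  R.closed ⟨M₃, g₁, g₂, R.comm h⟩ ⟨N, g₁ ≫ k, g₂ ≫ k, by simp [← Category.assoc, R.comm h]⟩
    (.single ⟨N, k, 𝟙 N, by simp, by simp⟩) h

theorem rel_of_comp {M₀ M₁ M₂ M₃ N : C} {f₁ : M₀ ⟶ M₁} {f₂ : M₀ ⟶ M₂} {g₁ : M₁ ⟶ M₃}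
    {g₂ : M₂ ⟶ M₃} (hc : f₁ ≫ g₁ = f₂ ≫ g₂) (k : M₃ ⟶ N)
    (h : R.rel f₁ f₂ (g₁ ≫ k) (g₂ ≫ k)) : R.rel f₁ f₂ g₁ g₂ :=
  R.closed ⟨N, g₁ ≫ k, g₂ ≫ k, R.comm h⟩ ⟨M₃, g₁, g₂, hc⟩
    (.single ⟨N, 𝟙 N, k, by simp, by simp⟩) h

variable (R) in
/-- Transitivity, existence and uniqueness. -/
structure Good : Prop where
  transitive : R.Transitive
  existence : R.Existence
  uniqueness : R.Uniqueness

theorem Existence.dual (h : R.Existence) : R.dual.Existence := fun f₁ f₂ =>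
  let ⟨N, g₁, g₂, hg⟩ := h f₂ f₁
  ⟨N, g₂, g₁, hg⟩

theorem Uniqueness.dual (h : R.Uniqueness) : R.dual.Uniqueness := fun a b ha hb =>
  (h a.swap b.swap ha hb).swap

theorem Good.dual (h : R.Good) : R.dual.Good :=
  ⟨⟨h.transitive.2, h.transitive.1⟩, Existence.dual h.existence,
    Uniqueness.dual h.uniqueness⟩

/-- Existence provides amalgamation, which makes `∼*` already transitive. -/
theorem Existence.equivStar_of_equiv (hE : R.Existence) {M₀ M₁ M₂ : C} {f₁ : M₀ ⟶ M₁}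
    {f₂ : M₀ ⟶ M₂} {a b : Amalgam f₁ f₂} (h : a.Equiv b) : a.EquivStar b := by
  induction h with
  | single h => exact h
  | @tail b c _ h₂ ih =>
    obtain ⟨N, ga, gb, h₁, h₁'⟩ := ih
    obtain ⟨N', gb', gc, h₂, h₂'⟩ := h₂
    obtain ⟨P, k, k', hk⟩ := hE gb gb'
    have hk := R.comm hk
    refine ⟨P, ga ≫ k, gc ≫ k', ?_, ?_⟩
    · rw [← Category.assoc, h₁, Category.assoc, hk, ← Category.assoc, h₂, Category.assoc]
    · rw [← Category.assoc, h₁', Category.assoc, hk, ← Category.assoc, h₂', Category.assoc]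

/-- Two independent amalgams of the same span embed in a common one. -/
theorem Good.exists_hom (hR : R.Good) {M₀ M₁ M₂ M₃ M₃' : C} {f₁ : M₀ ⟶ M₁} {f₂ : M₀ ⟶ M₂}
    {g₁ : M₁ ⟶ M₃} {g₂ : M₂ ⟶ M₃} {g₁' : M₁ ⟶ M₃'} {g₂' : M₂ ⟶ M₃'}
    (h : R.rel f₁ f₂ g₁ g₂) (h' : R.rel f₁ f₂ g₁' g₂') :
    ∃ (N : C) (k : M₃ ⟶ N) (k' : M₃' ⟶ N), g₁ ≫ k = g₁' ≫ k' ∧ g₂ ≫ k = g₂' ≫ k' :=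
  Existence.equivStar_of_equiv hR.existence
    (hR.uniqueness ⟨M₃, g₁, g₂, R.comm h⟩ ⟨M₃', g₁', g₂', R.comm h'⟩ h h')

/-- Monotonicity on the right. -/
theorem Good.mono_right (hR : R.Good) {M₀ M₁ M₂ M₂' M₃ : C} {f₁ : M₀ ⟶ M₁} {f₂ : M₀ ⟶ M₂}
    {k : M₂ ⟶ M₂'} {g₁ : M₁ ⟶ M₃} {g₂ : M₂' ⟶ M₃} (h : R.rel f₁ (f₂ ≫ k) g₁ g₂) :
    R.rel f₁ f₂ g₁ (k ≫ g₂) := by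
  -- Over `f₂ ≫ k`, an amalgam built in two steps has an independent inner square by construction;
  -- by uniqueness it is equivalent to the given one, and equivalence survives restriction to `M₂`.
  obtain ⟨P, a, b, hP⟩ := hR.existence f₁ f₂
  obtain ⟨Q, c, d, hQ⟩ := hR.existence b k
  have hPQ := hR.transitive.2 _ _ _ _ _ _ _ hP hQ
  have he := hR.uniqueness ⟨Q, a ≫ c, d, R.comm hPQ⟩ ⟨M₃, g₁, g₂, R.comm h⟩ hPQ h
  refine R.closed _ _ he.restrictRight ?_
  have := rel_comp hP c
  rwa [R.comm hQ] at this

/-- Monotonicity on the left. -/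
theorem Good.mono_left (hR : R.Good) {M₀ M₁ M₁' M₂ M₃ : C} {f₁ : M₀ ⟶ M₁} {f₂ : M₀ ⟶ M₂}
    {k : M₁ ⟶ M₁'} {g₁ : M₁' ⟶ M₃} {g₂ : M₂ ⟶ M₃} (h : R.rel (f₁ ≫ k) f₂ g₁ g₂) :
    R.rel f₁ f₂ (k ≫ g₁) g₂ :=
  hR.dual.mono_right h

/-- Base monotonicity on the right. -/
theorem Good.base_right (hR : R.Good) {M₀ M₀' M₁ M₂ M₃ : C} {f₁ : M₀ ⟶ M₁} {a : M₀ ⟶ M₀'}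
    {b : M₀' ⟶ M₂} {g₁ : M₁ ⟶ M₃} {g₂ : M₂ ⟶ M₃} (h : R.rel f₁ (a ≫ b) g₁ g₂) :
    ∃ (M₁' N : C) (c : M₁ ⟶ M₁') (d : M₀' ⟶ M₁') (g : M₁' ⟶ N) (k : M₃ ⟶ N),
      R.rel d b g (g₂ ≫ k) ∧ c ≫ g = g₁ ≫ k := by
  obtain ⟨P, c, d, hP⟩ := hR.existence f₁ a
  obtain ⟨Q, g, e, hQ⟩ := hR.existence d b
  obtain ⟨N, k, k', h₁, h₂⟩ := hR.exists_hom (hR.transitive.2 _ _ _ _ _ _ _ hP hQ) h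
  refine ⟨P, N, c, d, g ≫ k, k', ?_, by simpa using h₁⟩
  rw [← h₂]
  exact rel_comp hQ k

/-- Base monotonicity on the left. -/
theorem Good.base_left (hR : R.Good) {M₀ M₀' M₁ M₂ M₃ : C} {f₂ : M₀ ⟶ M₂} {a : M₀ ⟶ M₀'}
    {b : M₀' ⟶ M₁} {g₁ : M₁ ⟶ M₃} {g₂ : M₂ ⟶ M₃} (h : R.rel (a ≫ b) f₂ g₁ g₂) :
    ∃ (M₂' N : C) (c : M₂ ⟶ M₂') (d : M₀' ⟶ M₂') (g : M₂' ⟶ N) (k : M₃ ⟶ N),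
      R.rel b d (g₁ ≫ k) g ∧ c ≫ g = g₂ ≫ k :=
  hR.dual.base_right h

/-- An independent amalgam over `M₂` can be moved to one over any `S` inside an
extension of `M₂`. -/
theorem Good.transfer_right (hR : R.Good) {M₀ M₁ M₂ M₃ S : C} {f₁ : M₀ ⟶ M₁} {f₂ : M₀ ⟶ M₂}
    {g₁ : M₁ ⟶ M₃} {g₂ : M₂ ⟶ M₃} (h : R.rel f₁ f₂ g₁ g₂) {s : M₀ ⟶ S} {q : S ⟶ M₃}
    (hq : s ≫ q = f₂ ≫ g₂) :
    ∃ (N : C) (k k' : M₃ ⟶ N), g₂ ≫ k = g₂ ≫ k' ∧ R.rel f₁ s (g₁ ≫ k) (q ≫ k') := by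
  -- Take two copies of `M₃` independent over `M₂`. By transitivity `M₁` in the first copy is
  -- independent from the whole second copy, hence from the image of `S` there; the copies agree on
  -- `M₂`.
  obtain ⟨N, k, k', hN⟩ := hR.existence g₂ g₂
  have := hR.transitive.2 _ _ _ _ _ _ _ h hN
  rw [← hq] at this
  exact ⟨N, k, k', R.comm hN, hR.mono_right this⟩

/-- Left version of `Good.transfer_right`. -/
theorem Good.transfer_left (hR : R.Good) {M₀ M₁ M₂ M₃ S : C} {f₁ : M₀ ⟶ M₁} {f₂ : M₀ ⟶ M₂}
    {g₁ : M₁ ⟶ M₃} {g₂ : M₂ ⟶ M₃} (h : R.rel f₁ f₂ g₁ g₂) {s : M₀ ⟶ S} {q : S ⟶ M₃}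
    (hq : s ≫ q = f₁ ≫ g₁) :
    ∃ (N : C) (k k' : M₃ ⟶ N), g₁ ≫ k = g₁ ≫ k' ∧ R.rel s f₂ (q ≫ k') (g₂ ≫ k) :=
  hR.dual.transfer_right h hq

/-- Left-cancellation of independent squares. -/
theorem Good.nf_of_comp (hR : R.Good) {f g k : Arrow C} (h : f ⟶ g) (h' : g ⟶ k)
    (H : R.nf (h ≫ h')) : R.nf h := by
  -- Monotonicity cuts the right side down to `g.left`, closure under `∼` cuts the ambient model
  -- down to `g.right`; nothing is asked of `h'`.
  have := hR.mono_right (k := h'.left) (f₂ := h.left) H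
  refine rel_of_comp (k := h'.right) h.w.symm ?_
  rw [h'.w] at this
  exact this

end IndepRel

/-! ### Submodels, directed unions and Löwenheim–Skolem bounds -/

namespace AbstractClass

variable {τ : Vocabulary.{u}} {K : AbstractClass τ}

@[simp]
theorem fn_comp {M N P : K.Model} (f : M ⟶ N) (g : N ⟶ P) (x : M) :
    fn (f ≫ g) x = fn g (fn f x) := rfl

theorem fn_comp' {M N P : K.Model} (f : M ⟶ N) (g : N ⟶ P) : fn (f ≫ g) = fn g ∘ fn f := rfl

theorem fn_injective {M N : K.Model} (f : M ⟶ N) : Function.Injective (fn f) :=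
  (Hom.emb f).injective

theorem hom_ext {M N : K.Model} {f g : M ⟶ N} (h : ∀ x, fn f x = fn g x) : f = g :=
  Hom.ext (Emb.ext (funext h))

theorem fn_congr {M N : K.Model} {f g : M ⟶ N} (h : f = g) (x : M) : fn f x = fn g x := by rw [h]

instance {M N : K.Model} (f : M ⟶ N) : Mono f :=
  ⟨fun _ _ h => hom_ext fun x => fn_injective f (fn_congr h x)⟩

theorem range_fn_comp_subset {M N P : K.Model} (f : M ⟶ N) (g : N ⟶ P) :
    Set.range (fn (f ≫ g)) ⊆ Set.range (fn g) := by
  rintro _ ⟨x, rfl⟩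
  exact ⟨fn f x, rfl⟩

theorem mk_range_fn {M N : K.Model} (f : M ⟶ N) :
    Cardinal.mk (Set.range (fn f)) = Cardinal.mk M :=
  Cardinal.mk_range_eq _ (fn_injective f)

/-- An embedding of structures whose range is contained in the range of another one factors
through it. -/
theorem exists_emb_comp_eq {A B M : Str τ} (f : Emb A M) (g : Emb B M)
    (h : Set.range f.toFun ⊆ Set.range g.toFun) : ∃ k : Emb A B, g.comp k = f := by
  choose k hk using fun x => h ⟨x, rfl⟩
  have hk' : g.toFun ∘ k = f.toFun := funext hk
  refine ⟨⟨k, fun x y hxy => f.injective ?_, fun F x => g.injective ?_, fun r x => ?_⟩, ?_⟩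
  · rw [← hk, ← hk, hxy]
  · rw [hk, g.map_func, f.map_func, ← hk', Function.comp_assoc]
  · rw [← g.map_rel, ← f.map_rel, ← hk', Function.comp_assoc]
  · exact Emb.ext hk'

/-- Coherence upgrades the set-theoretic factorization to a `K`-embedding. -/
theorem IsMuAEC.exists_lift {μ : Cardinal.{u}} (hK : K.IsMuAEC μ) {A B M : K.Model} (f : A ⟶ M)
    (g : B ⟶ M) (h : Set.range (fn f) ⊆ Set.range (fn g)) : ∃ k : A ⟶ B, k ≫ g = f := by
  obtain ⟨k, hk⟩ := exists_emb_comp_eq (Hom.emb f) (Hom.emb g) h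
  exact ⟨⟨k, hK.coherence k (Hom.emb g) (Hom.strong g) (hk ▸ Hom.strong f)⟩, Hom.ext hk⟩

/-- A set of elements of `M` that carries a model `A ≤ M`. -/
def IsStrong (M : K.Model) (P : Set M) : Prop :=
  ∃ (A : K.Model) (f : A ⟶ M), Set.range (fn f) = P

theorem isStrong_range {M N : K.Model} (f : M ⟶ N) : IsStrong N (Set.range (fn f)) := ⟨M, f, rfl⟩

/-- The union of a `μ`-directed family of strong subsets is strong. -/
theorem IsMuAEC.isStrong_sUnion {μ : Cardinal.{u}} (hK : K.IsMuAEC μ) {M : K.Model}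
    (S : Set (Set M)) (hS : ∀ P ∈ S, IsStrong M P)
    (hdir : ∀ T : Set (Set M), T ⊆ S → Cardinal.mk T < μ → ∃ Q ∈ S, ∀ P ∈ T, P ⊆ Q) :
    IsStrong M (⋃₀ S) := by
  choose A f hf using fun P : S => hS P.1 P.2
  have hf' : ∀ P (hP : P ∈ S), Set.range (fn (f ⟨P, hP⟩)) = P := fun P hP => hf ⟨P, hP⟩
  -- Arities are below `μ`, so all arguments of a function symbol lie in one member of `S`.
  have hclosed : ∀ (F : τ.Func) (x : τ.funcArity F → M), (∀ i, x i ∈ ⋃₀ S) →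
      M.str.func F x ∈ ⋃₀ S := by
    intro F x hx
    choose P hP hxP using hx
    obtain ⟨Q, hQ, hPQ⟩ := hdir (Set.range P) (by rintro _ ⟨i, rfl⟩; exact hP i)
      (Cardinal.mk_range_le.trans_lt (hK.ary.1 F))
    have : ∀ i, ∃ y, fn (f ⟨Q, hQ⟩) y = x i := fun i => by
      have := hPQ (P i) ⟨i, rfl⟩ (hxP i)
      rwa [← hf' Q hQ] at this
    choose y hy using this
    refine ⟨Q, hQ, ?_⟩
    rw [← hf' Q hQ]
    exact ⟨_, ((Hom.emb (f ⟨Q, hQ⟩)).map_func F y).trans (congrArg _ (funext hy))⟩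
  let U : Str τ :=
    { carrier := ↥(⋃₀ S)
      func := fun F x => ⟨M.str.func F (fun i => (x i).1), hclosed F _ fun i => (x i).2⟩
      rel := fun r x => M.str.rel r (fun i => (x i).1) }
  let e : Emb U M.str := ⟨Subtype.val, Subtype.val_injective, fun _ _ => rfl, fun _ _ => Iff.rfl⟩
  have hsub : ∀ P Q : S, P ≤ Q → Set.range (fn (f P)) ⊆ Set.range (fn (f Q)) := fun P Q h => by
    rw [hf, hf]; exact h
  have hc : ∀ P : S, ∃ c : Emb (A P).str U, e.comp c = Hom.emb (f P) := fun P =>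
    exists_emb_comp_eq _ _ (by
      change Set.range (fn (f P)) ⊆ _
      rw [hf]
      exact fun x hx => ⟨⟨x, P.1, P.2, hx⟩, rfl⟩)
  choose c hc using hc
  obtain ⟨hU, -, hU'⟩ := hK.chain S (fun T hT => by
      obtain ⟨Q, hQ, h⟩ := hdir (Subtype.val '' T) (by rintro _ ⟨P, -, rfl⟩; exact P.2)
        (Cardinal.mk_image_le.trans_lt hT)
      exact ⟨⟨Q, hQ⟩, fun P hP => h P.1 ⟨P, hP, rfl⟩⟩) (fun P => (A P).str) U c
    (fun P Q hPQ => by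
      obtain ⟨k, hk⟩ := hK.exists_lift (f P) (f Q) (hsub P Q hPQ)
      refine ⟨Hom.emb k, Hom.strong k, Emb.ext (funext fun x => Subtype.ext ?_)⟩
      have h₁ := fn_congr hk x
      have h₂ := congrFun (congrArg Emb.toFun (hc P)) x
      have h₃ := congrFun (congrArg Emb.toFun (hc Q)) (fn k x)
      exact h₃.trans (h₁.trans h₂.symm))
    (by
      rintro ⟨x, P, hP, hx⟩
      rw [← hf' P hP] at hx
      obtain ⟨y, hy⟩ := hx
      exact ⟨⟨P, hP⟩, y, Subtype.ext ((congrFun (congrArg Emb.toFun (hc ⟨P, hP⟩)) y).trans hy)⟩)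
  refine ⟨⟨U, hU⟩, ⟨e, hU' _ e fun P => by rw [hc]; exact Hom.strong (f P)⟩, ?_⟩
  exact Subtype.range_val

/-- `ρ` bounds the size of the closures of sets of size at most `ρ`. -/
def LSTBound (K : AbstractClass τ) (ρ : Cardinal.{u}) : Prop :=
  ∀ (M : K.Model) (A : Set M), Cardinal.mk A ≤ ρ →
    ∃ (N : K.Model) (f : N ⟶ M), A ⊆ Set.range (fn f) ∧ Cardinal.mk N ≤ ρ

/-- There are arbitrarily large bounds for the Löwenheim–Skolem–Tarski axiom of the form `2 ^ b`. -/
theorem IsMuAEC.exists_lstBound {μ : Cardinal.{u}} (hK : K.IsMuAEC μ) (c : Cardinal.{u}) :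
    ∃ b : Cardinal.{u}, c ≤ b ∧ μ ≤ b ∧ K.LSTBound (2 ^ b) := by
  obtain ⟨l, -, -, hl⟩ := hK.lst
  let b := c + μ + l
  have hμb : μ ≤ b := (self_le_add_left μ c).trans (self_le_add_right _ l)
  have hb : Cardinal.aleph0 ≤ b := hK.regular.aleph0_le.trans hμb
  have hb' : Cardinal.aleph0 ≤ 2 ^ b := hb.trans (Cardinal.cantor b).le
  refine ⟨b, (self_le_add_right c μ).trans (self_le_add_right _ l), hμb, fun M A hA => ?_⟩
  obtain ⟨M₀, f, hf, hAf, hM⟩ := hl M.str M.mem A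
  refine ⟨⟨M₀, K.mem_left f hf⟩, ⟨f, hf⟩, hAf, hM.trans ?_⟩
  refine Cardinal.add_le_of_le hb' ?_ ((self_le_add_left l _).trans (Cardinal.cantor b).le)
  refine Cardinal.powerlt_le.2 fun x hx => ?_
  calc Cardinal.mk A ^ x ≤ (2 ^ b) ^ x := Cardinal.power_le_power_right hA
    _ = 2 ^ (b * x) := by rw [Cardinal.power_mul]
    _ ≤ 2 ^ b := Cardinal.power_le_power_left two_ne_zero
      (Cardinal.mul_le_of_le hb le_rfl (hx.le.trans hμb))

/-! ### Galois types -/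

theorem gtp_map {X : Type u} {M N : K.Model} (f : M ⟶ N) (a : X → M) :
    K.gtp N (fn f ∘ a) = K.gtp M a :=
  Quot.sound ⟨N, 𝟙 N, f, fun _ => rfl⟩

/-- With amalgamation, equality of Galois types is witnessed in one step. -/
theorem exists_hom_of_gtp_eq {X : Type u}
    (hA : ∀ {M₀ M₁ M₂ : K.Model} (f₁ : M₀ ⟶ M₁) (f₂ : M₀ ⟶ M₂),
      ∃ (N : K.Model) (g₁ : M₁ ⟶ N) (g₂ : M₂ ⟶ N), f₁ ≫ g₁ = f₂ ≫ g₂)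
    {M N : K.Model} {a : X → M} {b : X → N} (h : K.gtp M a = K.gtp N b) :
    ∃ (P : K.Model) (f : M ⟶ P) (g : N ⟶ P), ∀ x, fn f (a x) = fn g (b x) := by
  have key : ∀ p q : Σ M : K.Model, X → M, Relation.EqvGen (K.AtomicEq X) p q →
      K.AtomicEq X p q := by
    intro p q h
    induction h with
    | rel _ _ h => exact h
    | refl p => exact ⟨p.1, 𝟙 _, 𝟙 _, fun _ => rfl⟩
    | symm _ _ _ ih => obtain ⟨P, f, g, h⟩ := ih; exact ⟨P, g, f, fun x => (h x).symm⟩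
    | trans _ _ _ _ _ ih₁ ih₂ =>
      obtain ⟨P, f, g, h⟩ := ih₁
      obtain ⟨P', f', g', h'⟩ := ih₂
      obtain ⟨Q, k, k', hk⟩ := hA g f'
      refine ⟨Q, f ≫ k, g' ≫ k', fun x => ?_⟩
      rw [fn_comp, h, ← fn_comp, hk, fn_comp, h', fn_comp]
  exact key ⟨M, a⟩ ⟨N, b⟩ (Quot.eqvGen_exact h)

/-- There is only a small collection of Galois types of sequences of a given length. -/
theorem IsMuAEC.small_galoisType {μ : Cardinal.{u}} (hK : K.IsMuAEC μ) (X : Type u) :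
    Small.{u} (K.GaloisType X) := by
  obtain ⟨b, hb, -, hρ⟩ := hK.exists_lstBound (Cardinal.mk X)
  let L : Type u := (2 ^ b : Cardinal.{u}).out
  -- `T` codes structures on subsets of a set of size `2 ^ b`, with a sequence; every type is
  -- realized in an isomorphic copy of a coded model.
  let T : Type u := Σ c : Set L, ((∀ f : τ.Func, (τ.funcArity f → c) → c) ×
    (∀ r : τ.Rel, (τ.relArity r → c) → Prop)) × (X → c)
  let str : T → Str τ := fun t => ⟨t.1, t.2.1.1, t.2.1.2⟩
  let g : {t : T // K.mem (str t)} → K.GaloisType X := fun t => K.gtp ⟨str t.1, t.2⟩ t.1.2.2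
  refine small_of_surjective (f := g) fun q => ?_
  induction q using Quot.ind with
  | mk p =>
    obtain ⟨M, a⟩ := p
    obtain ⟨N, f, haf, hN⟩ := hρ M (Set.range a)
      (Cardinal.mk_range_le.trans (hb.trans (Cardinal.cantor b).le))
    choose a' ha' using fun x => haf ⟨x, rfl⟩
    have hN' : Cardinal.mk N ≤ Cardinal.mk L := by rwa [Cardinal.mk_out]
    obtain ⟨e⟩ := hN'
    let e' : N ≃ Set.range e := Equiv.ofInjective e e.injective
    let t : T := ⟨Set.range e, (fun F x => e' (N.str.func F (e'.symm ∘ x)),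
      fun r x => N.str.rel r (e'.symm ∘ x)), e' ∘ a'⟩
    let i : Emb N.str (str t) := ⟨e', e'.injective, fun F x => by
        change e' _ = e' (N.str.func F (e'.symm ∘ (e' ∘ x)))
        simp [← Function.comp_assoc], fun r x => by
        change N.str.rel r (e'.symm ∘ (e' ∘ x)) ↔ _
        simp [← Function.comp_assoc]⟩
    have hi := K.iso i e'.surjective N.mem
    refine ⟨⟨t, K.mem_right i hi⟩, ?_⟩
    have h₁ := gtp_map (K := K) (M := N) (N := ⟨str t, K.mem_right i hi⟩) ⟨i, hi⟩ a'
    have h₂ := gtp_map f a'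
    exact h₁.trans (h₂.symm.trans (congrArg _ (funext ha')))

end AbstractClass

/-! ### Reflecting a long sequence into a small submodel -/

/-- Sets closed under a family of operations with bounded arities can be found of bounded size,
uniformly in the underlying set. -/
theorem exists_closed_set (L : Type u) (Θ : Set L → Type u) :
    ∃ Ω : Type u, ∀ (M : Type u) (F : ∀ D : Set L, (D → M) → Θ D → M),
      ∃ N : Set M, Cardinal.mk N ≤ Cardinal.mk Ω ∧
        ∀ (D : Set L) (x : D → M), (∀ d, x d ∈ N) → ∀ θ, F D x θ ∈ N := by
  -- Well-founded terms in the operations: their number does not depend on `M`, and their values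
  -- form the closed set.
  refine ⟨WType (fun p : Σ D : Set L, Θ D => p.1), fun M F => ?_⟩
  let ev : WType (fun p : Σ D : Set L, Θ D => p.1) → M :=
    WType.elim M fun q => F q.1.1 q.2 q.1.2
  refine ⟨Set.range ev, Cardinal.mk_range_le, fun D x hx θ => ?_⟩
  choose w hw using hx
  refine ⟨WType.mk ⟨D, θ⟩ w, ?_⟩
  have : x = fun d => ev (w d) := funext fun d => (hw d).symm
  rw [this]
  rfl

theorem exists_range_eq_of_mk_le {L M : Type u} (X : Set M)
    (h : Cardinal.mk X ≤ Cardinal.mk L) : ∃ (D : Set L) (x : D → M), Set.range x = X := by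
  obtain ⟨e⟩ := h
  refine ⟨Set.range e, fun d => ((Equiv.ofInjective e e.injective).symm d).1, ?_⟩
  ext y
  constructor
  · rintro ⟨d, rfl⟩
    exact Subtype.prop _
  · exact fun hy => ⟨Equiv.ofInjective e e.injective ⟨y, hy⟩, by simp⟩

namespace AbstractClass

variable {τ : Vocabulary.{u}} {K : AbstractClass τ}

/-- A closing-off argument: `N` is closed under hulls of small sequences and under choosing an index
for each type that some `a j` realizes over such a sequence. Local character gives a small base in
`N`, enlarged to contain `B`; closure gives `j'`. The maps `p`, `q` witness that `a j` and `a j'`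
have the same type over `M₀`. -/
theorem IsMuAEC.exists_nonforking {μ : Cardinal.{u}} (hK : K.IsMuAEC μ) {R : IndepRel K.Model}
    (hR : R.Good) (hRLC : RightLocalCharacter R) (α : Type u) (c : Cardinal.{u}) :
    ∃ κ : Cardinal.{u}, κ.IsRegular ∧ μ ≤ κ ∧ ∀ (J : Type u) [LinearOrder J],
      (∀ s : Set J, Cardinal.mk s < κ → ∃ j, ∀ i ∈ s, i < j) →
      ∀ (M : K.Model) (a : J → α → M) (B : K.Model) (m : B ⟶ M), Cardinal.mk B ≤ c →
      ∃ (N : K.Model) (n : N ⟶ M), Cardinal.mk N < κ ∧ ∃ j₀, ∀ j, j₀ < j →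
        ∃ j' < j, (∃ a' : α → N, fn n ∘ a' = a j') ∧
          ∃ (M₀ S M₃ : K.Model) (t : M₀ ⟶ N) (s : M₀ ⟶ S) (b : α → S) (h : M ⟶ M₃)
            (p q : S ⟶ M₃) (m' : B ⟶ M₀), m' ≫ t ≫ n = m ∧ R.rel s t p (n ≫ h) ∧
            fn p ∘ b = fn h ∘ a j ∧ fn q ∘ b = fn h ∘ a j' ∧ s ≫ q = t ≫ n ≫ h := by
  obtain ⟨l, hl⟩ := hRLC α
  obtain ⟨b, hb, hμb, hρ⟩ := hK.exists_lstBound (l + c)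
  have hbinf : Cardinal.aleph0 ≤ b := hK.regular.aleph0_le.trans hμb
  have hb2 := (Cardinal.cantor b).le
  set ρ : Cardinal.{u} := 2 ^ b with hρdef
  have hinf : Cardinal.aleph0 ≤ ρ := hbinf.trans hb2
  have hlρ : l ≤ ρ := (self_le_add_right l c).trans (hb.trans hb2)
  have hcρ : c ≤ ρ := (self_le_add_left c l).trans (hb.trans hb2)
  let L : Type u := ρ.out
  have hL : Cardinal.mk L = ρ := Cardinal.mk_out ρ
  have := hK.small_galoisType
  -- Requests made over a sequence: `L` enumerates a hull, a type with `none` asks for an index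
  -- realizing it, and with `some u` for the `u`-th entry of the chosen sequence.
  let Θ : Set L → Type u := fun D => L ⊕ (Shrink.{u} (K.GaloisType (D ⊕ α)) × Option α)
  obtain ⟨Ω, hΩ⟩ := exists_closed_set L Θ
  have hκreg : (Order.succ (max (max Cardinal.aleph0 μ) (Cardinal.mk Ω))).IsRegular :=
    Cardinal.isRegular_succ ((le_max_left _ _).trans (le_max_left _ _))
  refine ⟨Order.succ (max (max Cardinal.aleph0 μ) (Cardinal.mk Ω)), hκreg,
    ((le_max_right _ _).trans (le_max_left _ _)).trans (Order.le_succ _), ?_⟩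
  intro J _ hJ M a B m hB
  have hΩκ : Cardinal.mk Ω < Order.succ (max (max Cardinal.aleph0 μ) (Cardinal.mk Ω)) :=
    Order.lt_succ_of_le (le_max_right _ _)
  generalize Order.succ (max (max Cardinal.aleph0 μ) (Cardinal.mk Ω)) = κ at *
  have : Nonempty J := by
    obtain ⟨j, -⟩ := hJ ∅ (by simpa using hκreg.pos)
    exact ⟨j⟩
  have claim : ∀ (D : Set L) (x : D → M), ∃ G : Θ D → M ⊕ J,
      (∃ P, IsStrong M P ∧ Set.range x ⊆ P ∧ Set.range (fn m) ⊆ P ∧ Cardinal.mk P ≤ ρ ∧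
        ∀ y ∈ P, ∃ θ, G θ = Sum.inl y) ∧
      ∀ j, ∃ j', K.gtp M (Sum.elim x (a j')) = K.gtp M (Sum.elim x (a j)) ∧
        (∃ θ, G θ = Sum.inr j') ∧ ∀ u, ∃ θ, G θ = Sum.inl (a j' u) := by
    intro D x
    obtain ⟨A, f, hf, hA⟩ := hρ M (Set.range x ∪ Set.range (fn m))
      ((Cardinal.mk_union_le _ _).trans (Cardinal.add_le_of_le hinf
        (Cardinal.mk_range_le.trans ((Cardinal.mk_set_le D).trans hL.le))
        (Cardinal.mk_range_le.trans (hB.trans hcρ))))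
    obtain ⟨e⟩ : Cardinal.mk A ≤ Cardinal.mk L := by rwa [hL]
    let T : K.GaloisType (D ⊕ α) → J := fun q =>
      Classical.epsilon fun j => K.gtp M (Sum.elim x (a j)) = q
    refine ⟨Sum.elim (Function.extend e (fun y => Sum.inl (fn f y))
      fun _ => Sum.inr (Classical.arbitrary J)) fun q =>
        q.2.elim (Sum.inr (T ((equivShrink _).symm q.1)))
          fun u => Sum.inl (a (T ((equivShrink _).symm q.1)) u),
      ⟨Set.range (fn f), isStrong_range f, Set.subset_union_left.trans hf,
        Set.subset_union_right.trans hf, (mk_range_fn f).trans_le hA, ?_⟩, ?_⟩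
    · rintro _ ⟨y, rfl⟩
      exact ⟨Sum.inl (e y), by rw [Sum.elim_inl, e.injective.extend_apply]⟩
    · intro j
      have hT : K.gtp M (Sum.elim x (a (T (K.gtp M (Sum.elim x (a j)))))) =
          K.gtp M (Sum.elim x (a j)) :=
        Classical.epsilon_spec (p := fun j' => K.gtp M (Sum.elim x (a j')) =
          K.gtp M (Sum.elim x (a j))) ⟨j, rfl⟩
      refine ⟨T (K.gtp M (Sum.elim x (a j))), hT,
        ⟨Sum.inr (equivShrink _ (K.gtp M (Sum.elim x (a j))), none), by simp⟩, fun u =>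
        ⟨Sum.inr (equivShrink _ (K.gtp M (Sum.elim x (a j))), some u), by simp⟩⟩
  choose G hG₁ hG₂ using claim
  -- Closing inside `M ⊕ J` bounds the elements and the indices used at the same time.
  obtain ⟨N', hN'Ω, hN'⟩ := hΩ (M ⊕ J) fun D x' => by
    classical exact if h : ∃ x : D → M, Sum.inl ∘ x = x' then G D h.choose else
      fun _ => Sum.inr (Classical.arbitrary J)
  have hGN : ∀ (D : Set L) (x : D → M), (∀ d, Sum.inl (x d) ∈ N') → ∀ θ, G D x θ ∈ N' := by
    intro D x hx θ
    have := hN' D (Sum.inl ∘ x) hx θ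
    have hex : ∃ y : D → M, (Sum.inl : M → M ⊕ J) ∘ y = Sum.inl ∘ x := ⟨x, rfl⟩
    have hch : hex.choose = x := Sum.inl_injective.comp_left hex.choose_spec
    rwa [dif_pos hex, hch] at this
  set Ns : Set M := Sum.inl ⁻¹' N' with hNs
  have hcover : ∀ X : Set M, X ⊆ Ns → Cardinal.mk X ≤ ρ →
      ∃ P, IsStrong M P ∧ P ⊆ Ns ∧ X ⊆ P ∧ Set.range (fn m) ⊆ P ∧ Cardinal.mk P ≤ ρ := by
    intro X hX hXρ
    obtain ⟨D, x, rfl⟩ := exists_range_eq_of_mk_le (L := L) X (by rwa [hL])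
    obtain ⟨P, hP, hxP, hmP, hPρ, hPG⟩ := hG₁ D x
    refine ⟨P, hP, fun y hy => ?_, hxP, hmP, hPρ⟩
    obtain ⟨θ, hθ⟩ := hPG y hy
    change Sum.inl y ∈ N'
    rw [← hθ]
    exact hGN D x (fun d => hX ⟨d, rfl⟩) θ
  have hstrong : IsStrong M Ns := by
    have := hK.isStrong_sUnion {P | IsStrong M P ∧ P ⊆ Ns ∧ Cardinal.mk P ≤ ρ}
      (fun P hP => hP.1) fun T hT hTμ => by
        obtain ⟨P, h₁, h₂, h₃, -, h₄⟩ := hcover (⋃₀ T) (Set.sUnion_subset fun P hP => (hT hP).2.1)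
          (by
            refine (Cardinal.mk_sUnion_le T).trans (Cardinal.mul_le_of_le hinf
              (hTμ.le.trans (hμb.trans hb2)) ?_)
            exact ciSup_le' fun P => (hT P.2).2.2)
        exact ⟨P, ⟨h₁, h₂, h₄⟩, fun Q hQ => (Set.subset_sUnion_of_mem hQ).trans h₃⟩
    convert this
    apply Set.Subset.antisymm
    · intro y hy
      obtain ⟨P, h₁, h₂, h₃, -, h₄⟩ := hcover {y} (by simpa using hy)
        (by simpa using (Cardinal.one_le_aleph0.trans hinf))
      exact ⟨P, ⟨h₁, h₂, h₄⟩, h₃ rfl⟩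
    · exact Set.sUnion_subset fun P hP => hP.2.1
  have hmN : Set.range (fn m) ⊆ Ns := by
    obtain ⟨P, -, h₂, -, h₃, -⟩ := hcover ∅ (Set.empty_subset _) (by simp)
    exact h₃.trans h₂
  obtain ⟨N, n, hn⟩ := hstrong
  have hNκ : Cardinal.mk N < κ := by
    rw [← mk_range_fn n, hn]
    exact ((Cardinal.mk_preimage_of_injective _ _ Sum.inl_injective).trans hN'Ω).trans_lt hΩκ
  -- Fewer than `κ` indices occur in `N'`; above all of them, any index supplied by the closure is
  -- automatically smaller than `j`.
  obtain ⟨j₀, hj₀⟩ := hJ (Sum.inr ⁻¹' N')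
    (((Cardinal.mk_preimage_of_injective _ _ Sum.inr_injective).trans hN'Ω).trans_lt hΩκ)
  refine ⟨N, n, hNκ, j₀, fun j hj => ?_⟩
  have hAP : ∀ {M₀ M₁ M₂ : K.Model} (f₁ : M₀ ⟶ M₁) (f₂ : M₀ ⟶ M₂),
      ∃ (N : K.Model) (g₁ : M₁ ⟶ N) (g₂ : M₂ ⟶ N), f₁ ≫ g₁ = f₂ ≫ g₂ := fun f₁ f₂ => by
    obtain ⟨N, g₁, g₂, h⟩ := hR.existence f₁ f₂
    exact ⟨N, g₁, g₂, R.comm h⟩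
  obtain ⟨M₀, i, hM₀, M₁, M₂, M₃, f₁, f₂, g₁, g₂, h, hrel, hcomm, hA, hB'⟩ := hl N M n (a j)
  obtain ⟨k, hk⟩ := hK.exists_lift (n ≫ h) g₂ (by
    rintro _ ⟨y, rfl⟩
    exact hB' ⟨_, ⟨y, rfl⟩, rfl⟩)
  have hik : i ≫ k = f₂ := by
    rw [← cancel_mono g₂, Category.assoc, hk, ← R.comm hrel, hcomm, Category.assoc]
  rw [← hik] at hrel
  have hrel₁ := hR.mono_right hrel
  rw [hk] at hrel₁
  obtain ⟨mN, hmN'⟩ := hK.exists_lift m n (by rwa [hn])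
  obtain ⟨M₀', t, ht, hM₀'⟩ := hρ N (Set.range (fn i) ∪ Set.range (fn mN))
    ((Cardinal.mk_union_le _ _).trans (Cardinal.add_le_of_le hinf
      (Cardinal.mk_range_le.trans (hM₀.trans hlρ)) (Cardinal.mk_range_le.trans (hB.trans hcρ))))
  obtain ⟨e, he⟩ := hK.exists_lift i t (Set.subset_union_left.trans ht)
  obtain ⟨m', hm'⟩ := hK.exists_lift mN t (Set.subset_union_right.trans ht)
  rw [← he] at hrel₁
  obtain ⟨S, Q, d₁, s, g, k₂, hrel₂, hd₁⟩ := hR.base_right hrel₁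
  rw [Category.assoc] at hrel₂
  choose b₀ hb₀ using fun u => hA ⟨a j u, ⟨u, rfl⟩, rfl⟩
  have hgb : ∀ u, fn g (fn d₁ (b₀ u)) = fn (h ≫ k₂) (a j u) := fun u => by
    rw [← fn_comp, hd₁, fn_comp, hb₀, fn_comp]
  obtain ⟨D, x, hx⟩ := exists_range_eq_of_mk_le (L := L) (Set.range (fn (t ≫ n)))
    (by rw [hL, mk_range_fn]; exact hM₀')
  have hxN : ∀ d, Sum.inl (x d) ∈ N' := fun d => by
    have : x d ∈ Ns := by
      rw [← hn]
      exact range_fn_comp_subset t n (hx ▸ ⟨d, rfl⟩)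
    exact this
  obtain ⟨j', hj', ⟨θ, hθ⟩, hj'u⟩ := hG₂ D x j
  have hj'j : j' < j := (hj₀ j' (by
    change Sum.inr j' ∈ N'
    rw [← hθ]
    exact hGN D x hxN θ)).trans hj
  have ha' : ∀ u, ∃ y, fn n y = a j' u := fun u => by
    have : a j' u ∈ Ns := by
      obtain ⟨θ, hθ⟩ := hj'u u
      change Sum.inl (a j' u) ∈ N'
      rw [← hθ]
      exact hGN D x hxN θ
    rwa [← hn] at this
  choose a' ha' using ha'
  -- Since `x` enumerates `M₀'`, equality of types makes `h₁` and `h₂` agree on `M₀'`. Two more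
  -- amalgamations put both copies of `S` in one extension of `M`.
  obtain ⟨P, h₂, h₁, hP⟩ := exists_hom_of_gtp_eq hAP hj'
  have htn : t ≫ n ≫ h₂ = t ≫ n ≫ h₁ := hom_ext fun y => by
    obtain ⟨d, hd⟩ : fn (t ≫ n) y ∈ Set.range x := hx ▸ ⟨y, rfl⟩
    have := hP (Sum.inl d)
    rw [Sum.elim_inl, Sum.elim_inl, hd] at this
    exact this
  obtain ⟨P', r₁, r₂, hr⟩ := hAP (h ≫ k₂) h₁
  obtain ⟨P'', w₁, w₂, hw⟩ := hAP (h₂ ≫ r₂) (h ≫ k₂)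
  refine ⟨j', hj'j, ⟨a', funext ha'⟩, M₀', S, P'', t, s, fn d₁ ∘ b₀, (h ≫ k₂) ≫ w₂, g ≫ w₂,
    g ≫ r₁ ≫ w₁, m', ?_, ?_, ?_, ?_, ?_⟩
  · rw [← Category.assoc, hm', hmN']
  · rw [← Category.assoc n]
    exact IndepRel.rel_comp hrel₂ w₂
  · funext u
    change fn w₂ (fn g (fn d₁ (b₀ u))) = fn w₂ (fn (h ≫ k₂) (a j u))
    rw [hgb]
  · funext u
    change fn w₁ (fn r₁ (fn g (fn d₁ (b₀ u)))) = fn ((h ≫ k₂) ≫ w₂) (a j' u)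
    have := hP (Sum.inr u)
    rw [Sum.elim_inr, Sum.elim_inr] at this
    rw [hgb, ← fn_comp _ r₁, hr, fn_comp, ← this, ← hw, fn_comp, fn_comp]
  · calc s ≫ g ≫ r₁ ≫ w₁ = (t ≫ n) ≫ ((h ≫ k₂) ≫ r₁) ≫ w₁ := by
          have := R.comm hrel₂
          simp only [← Category.assoc] at this ⊢
          rw [this]
      _ = (t ≫ n ≫ h₁) ≫ r₂ ≫ w₁ := by rw [hr]; simp only [Category.assoc]
      _ = (t ≫ n) ≫ ((h₂ ≫ r₂) ≫ w₁) := by rw [← htn]; simp only [Category.assoc]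
      _ = t ≫ n ≫ (h ≫ k₂) ≫ w₂ := by rw [hw]; simp only [Category.assoc]

end AbstractClass

/-! ### Long sequences of independent copies from chain bounds -/

theorem exists_lt_of_mk_lt_isRegular {κ : Cardinal.{u}} (hκ : κ.IsRegular) (s : Set κ.ord.ToType)
    (hs : Cardinal.mk s < κ) : ∃ j, ∀ i ∈ s, i < j := by
  by_contra! h
  have h₁ : IsCofinal s := fun j => by
    obtain ⟨i, hi, hj⟩ := h j
    exact ⟨i, hi, hj⟩
  have h₂ := Order.cof_le h₁
  have h₃ : Order.cof κ.ord.ToType = κ := by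
    rw [Ordinal.cof_toType, hκ.cof_ord]
  exact absurd (h₃.symm.trans_le h₂) hs.not_ge

/-- Construction of a sequence by well-founded recursion. -/
theorem exists_wellFounded_seq {J : Type u} [LinearOrder J] [WellFoundedLT J] {A : Type v}
    (Q : J → A → Prop) (r : A → A → Prop)
    (h : ∀ (k : J) (Y : Set.Iio k → A), (∀ i : Set.Iio k, Q i (Y i)) →
      (∀ i j, i < j → r (Y i) (Y j)) → ∃ z, Q k z ∧ ∀ i, r (Y i) z) :
    ∃ Z : J → A, (∀ k, Q k (Z k)) ∧ ∀ i k, i < k → r (Z i) (Z k) := by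
  rcases isEmpty_or_nonempty J with hJ | hJ
  · exact ⟨hJ.elim, hJ.elim, hJ.elim⟩
  have : Nonempty A := by
    obtain ⟨k, -, hk⟩ := (wellFounded_lt (α := J)).has_min Set.univ Set.univ_nonempty
    have he : IsEmpty (Set.Iio k) := ⟨fun i => hk i.1 trivial i.2⟩
    exact ⟨(h k isEmptyElim isEmptyElim isEmptyElim).choose⟩
  have h' : ∀ (k : J) (Y : ∀ i, i < k → A), ∃ z, (∀ i hi, Q i (Y i hi)) →
      (∀ i j hi hj, i < j → r (Y i hi) (Y j hj)) → Q k z ∧ ∀ i hi, r (Y i hi) z := by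
    intro k Y
    by_cases h₁ : (∀ i hi, Q i (Y i hi)) ∧ ∀ i j hi hj, i < j → r (Y i hi) (Y j hj)
    · obtain ⟨z, hz, hz'⟩ := h k (fun i => Y i.1 i.2) (fun i => h₁.1 _ _)
        fun i j hij => h₁.2 _ _ _ _ hij
      exact ⟨z, fun _ _ => ⟨hz, fun i hi => hz' ⟨i, hi⟩⟩⟩
    · exact ⟨Classical.arbitrary A, fun h₂ h₃ => (h₁ ⟨h₂, h₃⟩).elim⟩
  choose ext hext using h'
  let Z : J → A := (wellFounded_lt (α := J)).fix ext
  have hZ : ∀ k, Z k = ext k fun i _ => Z i := fun k => WellFounded.fix_eq _ _ _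
  have key : ∀ k, Q k (Z k) ∧ ∀ i < k, r (Z i) (Z k) := by
    intro k
    induction k using (wellFounded_lt (α := J)).induction with
    | _ k ih =>
      rw [hZ k]
      exact hext k (fun i _ => Z i) (fun i hi => (ih i hi).1)
        fun i j _ hj hij => (ih j hj).2 i hij
  exact ⟨Z, fun k => (key k).1, fun i k hik => (key k).2 i hik⟩

namespace AbstractClass

variable {τ : Vocabulary.{u}} {K : AbstractClass τ}

/-- An extension `X` of `M₀` whose elements are labelled injectively, with an embedding
of `S` over `M₀`. -/
structure Stage {M₀ S : K.Model} (s : M₀ ⟶ S) (V : Type w) where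
  X : K.Model
  lab : X → V
  inj : Function.Injective lab
  t : M₀ ⟶ X
  σ : S ⟶ X
  comm : s ≫ σ = t

namespace Stage

variable {M₀ S : K.Model} {s : M₀ ⟶ S} {V : Type w}

/-- Label preserving embeddings over `M₀`. -/
def IsHom (A B : Stage s V) (f : A.X ⟶ B.X) : Prop :=
  (∀ x, B.lab (fn f x) = A.lab x) ∧ A.t ≫ f = B.t

/-- Labels play the role of set-theoretic inclusions: as label preserving maps are unique, any
choice of them along a chain is functorial. -/
theorem IsHom.unique {A B : Stage s V} {f g : A.X ⟶ B.X} (hf : A.IsHom B f) (hg : A.IsHom B g) :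
    f = g :=
  hom_ext fun x => B.inj ((hf.1 x).trans (hg.1 x).symm)

theorem IsHom.id (A : Stage s V) : A.IsHom A (𝟙 _) := ⟨fun _ => rfl, Category.comp_id _⟩

theorem IsHom.comp {A B D : Stage s V} {f : A.X ⟶ B.X} {g : B.X ⟶ D.X} (hf : A.IsHom B f)
    (hg : B.IsHom D g) : A.IsHom D (f ≫ g) :=
  ⟨fun x => by rw [fn_comp, hg.1, hf.1], by rw [← Category.assoc, hf.2, hg.2]⟩

/-- The functor given by a chain of stages. -/
noncomputable def functor {I : Type u} [LinearOrder I] (Y : I → Stage s V)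
    (h : ∀ i j, i ≤ j → ∃ f, (Y i).IsHom (Y j) f) : I ⥤ K.Model where
  obj i := (Y i).X
  map f := (h _ _ (leOfHom f)).choose
  map_id i := (h i i le_rfl).choose_spec.unique (IsHom.id _)
  map_comp f g := (h _ _ (leOfHom (f ≫ g))).choose_spec.unique
    ((h _ _ (leOfHom f)).choose_spec.comp (h _ _ (leOfHom g)).choose_spec)

end Stage

theorem exists_isHom_of_lt {M₀ S : K.Model} {s : M₀ ⟶ S} {V : Type w} {I : Type u} [LinearOrder I]
    {Y : I → Stage s V} (h : ∀ i j, i < j → ∃ f, (Y i).IsHom (Y j) f) (i j : I) (hij : i ≤ j) :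
    ∃ f, (Y i).IsHom (Y j) f := by
  rcases hij.eq_or_lt with rfl | hij
  · exact ⟨_, Stage.IsHom.id _⟩
  · exact h i j hij

theorem HasChainBounds.exists_bound (hC : K.HasChainBounds) {M₀ S : K.Model} {s : M₀ ⟶ S}
    {V : Type w} {I : Type u} [LinearOrder I] [WellFoundedLT I] [Nonempty I] (Y : I → Stage s V)
    (h : ∀ i j, i ≤ j → ∃ f, (Y i).IsHom (Y j) f) :
    ∃ (P : K.Model) (ι : ∀ i, (Y i).X ⟶ P), ∀ i j (f : (Y i).X ⟶ (Y j).X), i ≤ j →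
      (Y i).IsHom (Y j) f → f ≫ ι j = ι i := by
  obtain ⟨c⟩ := hC I (Stage.functor Y h)
  refine ⟨c.pt, fun i => c.ι.app i, fun i j f hij hf => ?_⟩
  rw [hf.unique (h i j hij).choose_spec]
  exact c.w (homOfLE hij)

/-- The extension step in the construction of a sequence of independent copies of `S`. -/
theorem HasChainBounds.exists_stage (hC : K.HasChainBounds) {R : IndepRel K.Model} (hR : R.Good)
    {M₀ S : K.Model} (s : M₀ ⟶ S) {J : Type u} [LinearOrder J] [WellFoundedLT J] (k : J)
    (Y : Set.Iio k → Stage s (J × Σ T : Type u, T)) (hY : ∀ i x, ((Y i).lab x).1 ≤ i)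
    (hY' : ∀ i j, i < j → ∃ f, (Y i).IsHom (Y j) f) :
    ∃ Z : Stage s (J × Σ T : Type u, T), (∀ x, (Z.lab x).1 ≤ k) ∧
      ∀ i, ∃ f, (Y i).IsHom Z f ∧ R.rel (Y i).t s f Z.σ := by
  rcases isEmpty_or_nonempty (Set.Iio k) with hk | ⟨⟨i₀⟩⟩
  -- Chain bounds concern nonempty chains only, so the first stage is `S` itself.
  · exact ⟨⟨S, fun x => (k, ⟨S, x⟩), fun x y h => by simpa using h, s, 𝟙 S, Category.comp_id s⟩,
      fun _ => le_rfl, isEmptyElim⟩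
  have hle := exists_isHom_of_lt hY'
  have : Nonempty (Set.Iio k) := ⟨i₀⟩
  obtain ⟨U, ι, hι⟩ := hC.exists_bound Y hle
  have ht : ∀ {i j} (_ : i ≤ j), (Y i).t ≫ ι i = (Y j).t ≫ ι j := fun {i j} hij => by
    obtain ⟨f, hf⟩ := hle i j hij
    rw [← hι i j f hij hf, ← hf.2, Category.assoc]
  have ht₀ : ∀ i, (Y i₀).t ≫ ι i₀ = (Y i).t ≫ ι i := fun i => by
    rcases le_total i₀ i with h | h
    · exact ht h
    · exact (ht h).symm
  -- A bound of all earlier stages goes on the left of the new copy of `S`; left monotonicity then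
  -- handles each earlier stage.
  obtain ⟨P, v, σ, hP⟩ := hR.existence ((Y i₀).t ≫ ι i₀) s
  have hfn : ∀ {i j} (hij : i ≤ j) (x : (Y i).X),
      ∃ y : (Y j).X, (Y j).lab y = (Y i).lab x ∧ fn (ι j ≫ v) y = fn (ι i ≫ v) x :=
    fun {i j} hij x => by
      obtain ⟨f, hf⟩ := hle i j hij
      refine ⟨fn f x, hf.1 x, ?_⟩
      rw [← hι i j f hij hf]
      rfl
  have hiff : ∀ i j (x : (Y i).X) (y : (Y j).X),
      (Y i).lab x = (Y j).lab y ↔ fn (ι i ≫ v) x = fn (ι j ≫ v) y := by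
    have aux : ∀ i j (_ : i ≤ j) (x : (Y i).X) (y : (Y j).X),
        (Y i).lab x = (Y j).lab y ↔ fn (ι i ≫ v) x = fn (ι j ≫ v) y := fun i j hij x y => by
      obtain ⟨z, hz, hz'⟩ := hfn hij x
      rw [← hz, ← hz', (Y j).inj.eq_iff, (fn_injective _).eq_iff]
    intro i j x y
    rcases le_total i j with h | h
    · exact aux i j h x y
    · rw [eq_comm, aux j i h y x, eq_comm]
  classical
  -- Old elements keep their labels, whose first coordinate is below `k`; new ones get first
  -- coordinate `k`, so no clash occurs.
  let lab : P → J × Σ T : Type u, T := fun z =>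
    if h : ∃ p : Σ i, (Y i).X, fn (ι p.1 ≫ v) p.2 = z then (Y h.choose.1).lab h.choose.2
    else (k, ⟨P, z⟩)
  have hlab : ∀ i (x : (Y i).X), lab (fn (ι i ≫ v) x) = (Y i).lab x := fun i x => by
    have h : ∃ p : Σ i, (Y i).X, fn (ι p.1 ≫ v) p.2 = fn (ι i ≫ v) x := ⟨⟨i, x⟩, rfl⟩
    have : lab (fn (ι i ≫ v) x) = (Y h.choose.1).lab h.choose.2 := dif_pos h
    rw [this, hiff, h.choose_spec]
  have hlab' : ∀ z, (¬ ∃ p : Σ i, (Y i).X, fn (ι p.1 ≫ v) p.2 = z) → lab z = (k, ⟨P, z⟩) :=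
    fun z h => dif_neg h
  have hlt : ∀ i (x : (Y i).X), ((Y i).lab x).1 < k := fun i x => (hY i x).trans_lt i.2
  refine ⟨⟨P, lab, ?_, s ≫ σ, σ, rfl⟩, ?_, fun i => ⟨ι i ≫ v, ⟨hlab i, ?_⟩, ?_⟩⟩
  · intro z z' h
    by_cases hz : ∃ p : Σ i, (Y i).X, fn (ι p.1 ≫ v) p.2 = z <;>
      by_cases hz' : ∃ p : Σ i, (Y i).X, fn (ι p.1 ≫ v) p.2 = z'
    · obtain ⟨⟨i, x⟩, rfl⟩ := hz
      obtain ⟨⟨j, y⟩, rfl⟩ := hz'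
      rw [hlab, hlab] at h
      exact (hiff _ _ _ _).1 h
    · obtain ⟨⟨i, x⟩, rfl⟩ := hz
      rw [hlab, hlab' _ hz'] at h
      exact absurd (hlt i x) (by rw [h]; exact lt_irrefl _)
    · obtain ⟨⟨i, x⟩, rfl⟩ := hz'
      rw [hlab, hlab' _ hz] at h
      exact absurd (hlt i x) (by rw [← h]; exact lt_irrefl _)
    · rw [hlab' _ hz, hlab' _ hz'] at h
      simpa using h
  · intro z
    by_cases hz : ∃ p : Σ i, (Y i).X, fn (ι p.1 ≫ v) p.2 = z
    · obtain ⟨⟨i, x⟩, rfl⟩ := hz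
      exact (congrArg Prod.fst (hlab i x)).trans_le (hlt i x).le
    · exact (congrArg Prod.fst (hlab' z hz)).le
  · change (Y i).t ≫ ι i ≫ v = s ≫ σ
    rw [← R.comm hP, ht₀ i, Category.assoc]
  · rw [ht₀ i] at hP
    exact hR.mono_left hP

/-- With chain bounds, there are long sequences of copies of `S` over `M₀` such that
every copy has on its left a model containing the previous ones. -/
theorem IsMuAEC.exists_independent_seq {μ : Cardinal.{u}} (hK : K.IsMuAEC μ)
    (hC : K.HasChainBounds) {R : IndepRel K.Model} (hR : R.Good) {M₀ S : K.Model} (s : M₀ ⟶ S)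
    (J : Type u) [LinearOrder J] [WellFoundedLT J] [Nonempty J]
    (hJ : ∀ T : Set J, Cardinal.mk T < μ → ∃ j, ∀ i ∈ T, i < j) :
    ∃ (M : K.Model) (m : M₀ ⟶ M) (X : J → K.Model) (e : ∀ j, X j ⟶ M) (t : ∀ j, M₀ ⟶ X j)
      (σ : ∀ j, S ⟶ X j), (∀ j, s ≫ σ j = t j) ∧ (∀ j, t j ≫ e j = m) ∧
      (∀ i j, i < j → ∃ f : X i ⟶ X j, f ≫ e j = e i ∧ R.rel (t i) s f (σ j)) ∧
      ∀ x, ∃ j, x ∈ Set.range (fn (e j)) := by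
  obtain ⟨Z, -, hZ⟩ := exists_wellFounded_seq (J := J) (A := Stage s (J × Σ T : Type u, T))
    (fun k Z => ∀ x, (Z.lab x).1 ≤ k) (fun A B => ∃ f, A.IsHom B f ∧ R.rel A.t s f B.σ)
    fun k Y h₁ h₂ => hC.exists_stage hR s k Y h₁ fun i j hij =>
      let ⟨f, hf⟩ := h₂ i j hij
      ⟨f, hf.1⟩
  have hle := exists_isHom_of_lt (Y := Z) fun i j hij =>
    let ⟨f, hf⟩ := hZ i j hij
    ⟨f, hf.1⟩
  obtain ⟨U, ι, hι⟩ := hC.exists_bound Z hle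
  have hmono : ∀ {i j} (_ : i ≤ j), Set.range (fn (ι i)) ⊆ Set.range (fn (ι j)) :=
    fun {i j} hij => by
      obtain ⟨f, hf⟩ := hle i j hij
      rw [← hι i j f hij hf]
      exact range_fn_comp_subset _ _
  -- The bound `U` may have extra elements. The union of the stages is `μ`-directed, hence a model,
  -- and each of its elements lies in some stage.
  obtain ⟨M, m, hm⟩ := hK.isStrong_sUnion (Set.range fun i => Set.range (fn (ι i)))
    (by rintro _ ⟨i, rfl⟩; exact isStrong_range _) fun T hT hTμ => by
      choose idx hidx using fun P : T => hT P.2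
      obtain ⟨j, hj⟩ := hJ (Set.range idx) (Cardinal.mk_range_le.trans_lt hTμ)
      refine ⟨_, ⟨j, rfl⟩, fun P hP => ?_⟩
      have := hidx ⟨P, hP⟩
      rw [← show _ = P from this]
      exact hmono (hj _ ⟨_, rfl⟩).le
  have hlift : ∀ i, ∃ e : (Z i).X ⟶ M, e ≫ m = ι i := fun i =>
    hK.exists_lift _ _ (by rw [hm]; exact Set.subset_sUnion_of_mem ⟨i, rfl⟩)
  choose e he using hlift
  have hFe : ∀ i j (f : (Z i).X ⟶ (Z j).X), i ≤ j → (Z i).IsHom (Z j) f → f ≫ e j = e i :=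
    fun i j f hij hf => by rw [← cancel_mono m, Category.assoc, he, he, hι i j f hij hf]
  have ht : ∀ {i j} (_ : i ≤ j), (Z i).t ≫ e i = (Z j).t ≫ e j := fun {i j} hij => by
    obtain ⟨f, hf⟩ := hle i j hij
    rw [← hFe i j f hij hf, ← hf.2, Category.assoc]
  let i₀ : J := Classical.arbitrary J
  refine ⟨M, (Z i₀).t ≫ e i₀, fun i => (Z i).X, e, fun i => (Z i).t, fun i => (Z i).σ,
    fun i => (Z i).comm, fun i => ?_, fun i j hij => ?_, fun x => ?_⟩
  · rcases le_total i i₀ with h | h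
    · exact ht h
    · exact (ht h).symm
  · obtain ⟨f, hf, hr⟩ := hZ i j hij
    exact ⟨f, hFe i j f hij.le hf, hr⟩
  · have hx : fn m x ∈ Set.range (fn m) := ⟨x, rfl⟩
    rw [hm] at hx
    obtain ⟨_, ⟨i, rfl⟩, y, hy⟩ := hx
    refine ⟨i, y, fn_injective m ?_⟩
    rw [← fn_comp, he, hy]

/-! ### Asymmetric pairs and the contradiction -/

/-- Independent pairs over `M₀` of realizations of given types have the same Galois type. -/
theorem gtp_pair_eq {R : IndepRel K.Model} (hR : R.Good) {α : Type u} {M₀ S Q Q' : K.Model}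
    {s : M₀ ⟶ S} {p q : S ⟶ Q} {p' q' : S ⟶ Q'} (h : R.rel s s p q) (h' : R.rel s s p' q')
    (b : α → S) :
    K.gtp Q (Sum.elim (fn p ∘ b) (fn q ∘ b)) = K.gtp Q' (Sum.elim (fn p' ∘ b) (fn q' ∘ b)) ∧
    K.gtp Q (Sum.elim (fn q ∘ b) (fn p ∘ b)) = K.gtp Q' (Sum.elim (fn q' ∘ b) (fn p' ∘ b)) := by
  obtain ⟨N, k, k', h₁, h₂⟩ := hR.exists_hom h h'
  constructor <;>
  · rw [← gtp_map k, ← gtp_map k', Sum.comp_elim, Sum.comp_elim]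
    simp only [← Function.comp_assoc, ← fn_comp', h₁, h₂]

theorem gtp_pair_map {α : Type u} {M N : K.Model} (g : M ⟶ N) (a b : α → M) :
    K.gtp N (Sum.elim (fn g ∘ a) (fn g ∘ b)) = K.gtp M (Sum.elim a b) := by
  rw [← gtp_map g, Sum.comp_elim]

/-- From the configuration provided by `IsMuAEC.exists_nonforking`, an independent pair of
realizations of the same type. -/
theorem exists_rel_of_nonforking {R : IndepRel K.Model} (hR : R.Good) {α : Type u}
    {M₀ N M S M₃ : K.Model} {t : M₀ ⟶ N} {n : N ⟶ M} {s : M₀ ⟶ S} {b : α → S} {h : M ⟶ M₃}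
    {p q : S ⟶ M₃} {a a' : α → M} {a'' : α → N} (ha'' : fn n ∘ a'' = a')
    (hrel : R.rel s t p (n ≫ h)) (hp : fn p ∘ b = fn h ∘ a) (hq : fn q ∘ b = fn h ∘ a')
    (hc : s ≫ q = t ≫ n ≫ h) :
    ∃ (Q : K.Model) (g : M ⟶ Q) (p' q' : S ⟶ Q), R.rel s s p' q' ∧ fn p' ∘ b = fn g ∘ a ∧
      fn q' ∘ b = fn g ∘ a' := by
  -- `k` and `k'` agree on `N`, which contains `a'`, so moving `q` along `k'` leaves the image of
  -- `a'` unchanged.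
  obtain ⟨Q, k, k', hk, hr⟩ := hR.transfer_right hrel hc
  refine ⟨Q, h ≫ k, p ≫ k, q ≫ k', hr, ?_, ?_⟩
  · rw [fn_comp', fn_comp', Function.comp_assoc, hp, Function.comp_assoc]
  · rw [fn_comp', Function.comp_assoc, hq, ← ha'']
    have : fn k' ∘ fn h ∘ fn n ∘ a'' = fn ((n ≫ h) ≫ k') ∘ a'' := rfl
    rw [this, ← hk]
    rfl

/-- The order property gives a type over a model whose square is not symmetric. -/
theorem IsMuAEC.exists_asymmetric {μ : Cardinal.{u}} (hK : K.IsMuAEC μ) {R : IndepRel K.Model}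
    (hR : R.Good) (hRLC : RightLocalCharacter R) (hOP : K.OrderProperty) :
    ∃ (α : Type u) (M₀ S Q : K.Model) (s : M₀ ⟶ S) (b : α → S) (p q : S ⟶ Q), R.rel s s p q ∧
      K.gtp Q (Sum.elim (fn p ∘ b) (fn q ∘ b)) ≠ K.gtp Q (Sum.elim (fn q ∘ b) (fn p ∘ b)) := by
  obtain ⟨α, hα⟩ := hOP
  obtain ⟨c, -, -, hc⟩ := hK.exists_lstBound 0
  obtain ⟨κ, hκ, -, H⟩ := hK.exists_nonforking hR hRLC α (2 ^ c)
  obtain ⟨M, a, ha⟩ := hα κ.ord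
  -- No submodel need be kept in the base here: `B` is just a hull of the empty set.
  obtain ⟨B, m, -, hB⟩ := hc M ∅ (by simp)
  obtain ⟨N, n, -, j₀, hN⟩ := H κ.ord.ToType (exists_lt_of_mk_lt_isRegular hκ) M
    (fun j => a (Ordinal.ToType.mk.symm j)) B m hB
  obtain ⟨j, hj⟩ := exists_lt_of_mk_lt_isRegular hκ {j₀}
    (by simpa using Cardinal.one_lt_aleph0.trans_le hκ.aleph0_le)
  obtain ⟨j', hj', ⟨a', ha'⟩, M₀, S, M₃, t, s, b, h, p, q, -, -, hrel, hp, hq, hs⟩ :=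
    hN j (hj j₀ rfl)
  obtain ⟨Q, g, p', q', hr, hp', hq'⟩ := exists_rel_of_nonforking hR ha' hrel hp hq hs
  refine ⟨α, M₀, S, Q, s, b, p', q', hr, ?_⟩
  rw [hp', hq', gtp_pair_map, gtp_pair_map]
  have hlt : Ordinal.ToType.mk.symm j' < Ordinal.ToType.mk.symm j :=
    Ordinal.ToType.mk.symm.strictMono hj'
  exact (ha _ _ _ _ hlt hlt).symm

theorem IsMuAEC.not_orderProperty_of_symmetric {μ : Cardinal.{u}} (hK : K.IsMuAEC μ)
    {R : IndepRel K.Model} (hR : R.Good) (hRLC : RightLocalCharacter R) (hs : R.Symmetric) :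
    ¬ K.OrderProperty := fun hOP => by
  obtain ⟨α, M₀, S, Q, s, b, p, q, hr, hne⟩ := hK.exists_asymmetric hR hRLC hOP
  have hr' : R.rel s s q p := by
    rw [hs]
    exact hr
  exact hne (gtp_pair_eq hR hr hr' b).1

/-- Along the constructed sequence the earlier element is on the left, while local character puts
the later one on the left. Over a common base both are independent pairs of the same type, so
uniqueness makes the two orderings indistinguishable. -/
theorem IsMuAEC.not_orderProperty_of_hasChainBounds {μ : Cardinal.{u}} (hK : K.IsMuAEC μ)
    {R : IndepRel K.Model} (hR : R.Good) (hRLC : RightLocalCharacter R) (hC : K.HasChainBounds) :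
    ¬ K.OrderProperty := fun hOP => by
  obtain ⟨α, M₀, S, Q, s, b, p, q, hr, hne⟩ := hK.exists_asymmetric hR hRLC hOP
  obtain ⟨κ, hκ, hμκ, H⟩ := hK.exists_nonforking hR hRLC α (Cardinal.mk M₀)
  have hJ := exists_lt_of_mk_lt_isRegular hκ
  have : Nonempty κ.ord.ToType := by
    obtain ⟨j, -⟩ := hJ ∅ (by simpa using hκ.pos)
    exact ⟨j⟩
  obtain ⟨M, m, X, e, t, σ, hσ, ht, hX, hcov⟩ := hK.exists_independent_seq hC hR s κ.ord.ToType
    fun T hT => hJ T (hT.trans_le hμκ)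
  have hpair : ∀ i j, i < j → R.rel s s (σ i ≫ e i) (σ j ≫ e j) := fun i j hij => by
    obtain ⟨f, hf, hf'⟩ := hX i j hij
    rw [← hσ] at hf'
    have := IndepRel.rel_comp (hR.mono_left hf') (e j)
    rwa [Category.assoc, hf] at this
  -- Taking `B` to be `M₀` forces the new base `M₁` to extend `M₀`, which base monotonicity requires
  -- below.
  obtain ⟨N, n, hNκ, j₀, hN⟩ := H κ.ord.ToType hJ M (fun j => fn (σ j ≫ e j) ∘ b) M₀ m le_rfl
  choose idx hidx using fun y => hcov (fn n y)
  obtain ⟨l, hl⟩ := hJ (Set.range idx) (Cardinal.mk_range_le.trans_lt hNκ)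
  obtain ⟨v, hv⟩ := hK.exists_lift n (e l) (by
    rintro _ ⟨y, rfl⟩
    obtain ⟨f, hf, -⟩ := hX (idx y) l (hl _ ⟨y, rfl⟩)
    have := hidx y
    rw [← hf] at this
    exact range_fn_comp_subset _ _ this)
  obtain ⟨j, hj⟩ := hJ {max j₀ l} (by simpa using Cardinal.one_lt_aleph0.trans_le hκ.aleph0_le)
  have hj := max_lt_iff.1 (hj _ rfl)
  obtain ⟨j', hj', ⟨a', ha'⟩, M₁, S', M₃, t', s', b', h, p₁, q₁, m', hm', hrel, hp, hq, hs⟩ :=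
    hN j hj.1
  -- First independent pair over `M₁`: the `j`-th copy on the left, the `j'`-th on the right.
  obtain ⟨Q₀, g₀, p₀, q₀, hr₀, hp₀, hq₀⟩ := exists_rel_of_nonforking hR ha' hrel hp hq hs
  obtain ⟨f, hf, hf'⟩ := hX l j hj.2
  have htl : (m' ≫ t') ≫ v = t l := by
    rw [← cancel_mono (e l), Category.assoc, hv, Category.assoc, hm', ht]
  have h₁ := IndepRel.rel_comp hf' (e j)
  rw [hf, ← htl] at h₁
  have h₂ := hR.mono_left h₁
  rw [hv] at h₂
  -- Over `M₁`, the model `N`, which contains the `j'`-th sequence, is on the left of `S₁`, which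
  -- contains the `j`-th. The two transfers replace `N` and `S₁` by copies of `S'`, giving the
  -- second pair in the opposite order.
  obtain ⟨S₁, P, c, d, g, k, h₃, hcg⟩ := hR.base_left h₂
  obtain ⟨P₁, w₁, w₂, hw⟩ := hR.existence k h
  have hw := R.comm hw
  have h₄ := IndepRel.rel_comp h₃ w₁
  have e₁ : s' ≫ q₁ ≫ w₂ = t' ≫ (n ≫ k) ≫ w₁ := by
    rw [← Category.assoc, hs]
    simp only [Category.assoc, hw]
  obtain ⟨P₂, k₁, k₁', hk₁, h₅⟩ := hR.transfer_left h₄ e₁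
  have e₂ : s' ≫ p₁ ≫ w₂ ≫ k₁ = d ≫ (g ≫ w₁) ≫ k₁ := by
    have h₆ := R.comm h₄
    have h₇ := R.comm hrel
    calc s' ≫ p₁ ≫ w₂ ≫ k₁ = (s' ≫ p₁) ≫ w₂ ≫ k₁ := by simp only [Category.assoc]
      _ = t' ≫ n ≫ (h ≫ w₂) ≫ k₁ := by rw [h₇]; simp only [Category.assoc]
      _ = (t' ≫ (n ≫ k) ≫ w₁) ≫ k₁ := by rw [← hw]; simp only [Category.assoc]
      _ = d ≫ (g ≫ w₁) ≫ k₁ := by rw [h₆]; simp only [Category.assoc]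
  obtain ⟨P₃, k₂, k₂', hk₂, h₆⟩ := hR.transfer_right h₅ e₂
  let G : M ⟶ P₃ := k ≫ w₁ ≫ k₁ ≫ k₂
  have hG : fn (((q₁ ≫ w₂) ≫ k₁') ≫ k₂) ∘ b' = fn G ∘ fn (σ j' ≫ e j') ∘ b := by
    funext u
    have i₁ := congrFun hq u
    have i₂ := congrFun ha' u
    simp only [Function.comp_apply] at i₁ i₂
    change fn (w₂ ≫ k₁' ≫ k₂) (fn q₁ (b' u)) = fn G (fn (σ j' ≫ e j') (b u))
    rw [i₁, ← i₂]
    have i₃ : n ≫ h ≫ w₂ ≫ k₁' ≫ k₂ = n ≫ G := by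
      calc n ≫ h ≫ w₂ ≫ k₁' ≫ k₂ = n ≫ (h ≫ w₂) ≫ k₁' ≫ k₂ := by simp only [Category.assoc]
        _ = (((n ≫ k) ≫ w₁) ≫ k₁') ≫ k₂ := by rw [← hw]; simp only [Category.assoc]
        _ = n ≫ G := by rw [← hk₁]; simp only [G, Category.assoc]
    exact fn_congr i₃ (a' u)
  have hG' : fn ((p₁ ≫ w₂ ≫ k₁) ≫ k₂') ∘ b' = fn G ∘ fn (σ j ≫ e j) ∘ b := by
    funext u
    have i₁ := congrFun hp u
    simp only [Function.comp_apply] at i₁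
    change fn (w₂ ≫ k₁ ≫ k₂') (fn p₁ (b' u)) = fn G (fn (σ j ≫ e j) (b u))
    rw [i₁]
    have i₃ : (σ j ≫ e j) ≫ h ≫ w₂ ≫ k₁ ≫ k₂' = (σ j ≫ e j) ≫ G := by
      calc (σ j ≫ e j) ≫ h ≫ w₂ ≫ k₁ ≫ k₂'
          = (σ j ≫ e j) ≫ (h ≫ w₂) ≫ k₁ ≫ k₂' := by simp only [Category.assoc]
        _ = ((σ j ≫ e j) ≫ k) ≫ w₁ ≫ k₁ ≫ k₂' := by rw [← hw]; simp only [Category.assoc]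
        _ = c ≫ ((g ≫ w₁) ≫ k₁) ≫ k₂' := by rw [← hcg]; simp only [Category.assoc]
        _ = (c ≫ g) ≫ w₁ ≫ k₁ ≫ k₂ := by rw [← hk₂]; simp only [Category.assoc]
        _ = (σ j ≫ e j) ≫ G := by rw [hcg]; simp only [G, Category.assoc]
    exact fn_congr i₃ (b u)
  have E₁ := (gtp_pair_eq hR hr₀ h₆ b').1
  rw [hp₀, hq₀, hG, hG', gtp_pair_map, gtp_pair_map] at E₁
  obtain ⟨E₂, E₃⟩ := gtp_pair_eq hR hr (hpair j' j hj') b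
  exact hne (E₂.trans (E₁.symm.trans E₃.symm))

end AbstractClass

/-! ### Right local character from accessibility -/

/-- In a `κ`-directed poset, sets of size at most `2 ^ b` are contained in `κ`-directed subsets
of size at most `2 ^ b`. -/
theorem exists_isCardinalFiltered_superset {κ b : Cardinal.{u}} [hκ : Fact κ.IsRegular]
    (hκb : κ ≤ b) {X : Type u} [PartialOrder X] [IsCardinalFiltered X κ] (A : Set X)
    (hA : Cardinal.mk A ≤ 2 ^ b) :
    ∃ B : Set X, A ⊆ B ∧ IsCardinalFiltered B κ ∧ Cardinal.mk B ≤ 2 ^ b := by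
  have hb : Cardinal.aleph0 ≤ b := hκ.out.aleph0_le.trans hκb
  have hb2 : b ≤ 2 ^ b := (Cardinal.cantor b).le
  have : Fact (Order.succ ((2 : Cardinal.{u}) ^ b)).IsRegular :=
    ⟨Cardinal.isRegular_succ (hb.trans hb2)⟩
  obtain ⟨B, hAB, hB, hB'⟩ :=
    Cardinal.SharplyLT.exists_isCardinalFiltered_set_of_exists_cofinal (κ₁ := κ)
      (κ₂ := Order.succ ((2 : Cardinal.{u}) ^ b)) (Order.lt_succ_of_le (hκb.trans hb2))
      -- A set of size at most `2 ^ b` has at most `(2 ^ b) ^ b = 2 ^ b` subsets of size below `κ`,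
      -- so the family of all of them is small enough.
      (fun Y hY => ⟨Set.univ, by
        rw [hasCardinalLT_iff_cardinal_mk_lt, Order.lt_succ_iff] at hY ⊢
        rw [Cardinal.mk_univ]
        have h₁ : Cardinal.mk {S : Set Y // HasCardinalLT S κ} ≤
            Cardinal.mk {t : Set Y // Cardinal.mk t ≤ b} :=
          Cardinal.mk_subtype_mono fun t ht =>
            ((hasCardinalLT_iff_cardinal_mk_lt _ _).1 ht).le.trans hκb
        refine h₁.trans ((Cardinal.mk_bounded_set_le Y b).trans ?_)
        calc max (Cardinal.mk Y) Cardinal.aleph0 ^ b ≤ (2 ^ b) ^ b :=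
              Cardinal.power_le_power_right (max_le hY (hb.trans hb2))
          _ = 2 ^ b := by rw [← Cardinal.power_mul, Cardinal.mul_eq_self hb],
        fun t => ⟨t, trivial, le_rfl⟩⟩) A
      (by rwa [hasCardinalLT_iff_cardinal_mk_lt, Order.lt_succ_iff])
  rw [hasCardinalLT_iff_cardinal_mk_lt, Order.lt_succ_iff] at hB'
  exact ⟨B, hAB, hB, hB'⟩

/-- The colimit of the restriction of a diagram to a `κ`-directed subset, with its comparison map
to a cocone over the whole diagram. -/
theorem exists_colimit_restrict {W : Type v} [Category.{w} W] (κ : Cardinal.{u})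
    [Fact κ.IsRegular] [HasCardinalFilteredColimits.{u} W κ] {I : Type u} [PartialOrder I]
    (D : I ⥤ W) (c : Limits.Cocone D) (B : Set I) [IsCardinalFiltered B κ] :
    ∃ (Y : W) (ι : ∀ i : B, D.obj i ⟶ Y) (d : Y ⟶ c.pt), (∀ i, ι i ≫ d = c.ι.app i.1) ∧
      (∀ (Z : W) (f g : Y ⟶ Z), (∀ i, ι i ≫ f = ι i ≫ g) → f = g) ∧
      ∀ (Z : W) (φ : ∀ i : B, D.obj i ⟶ Z),
        (∀ (i j : B) (f : i.1 ⟶ j.1), D.map f ≫ φ j = φ i) → ∃ g : Y ⟶ Z, ∀ i, ι i ≫ g = φ i := by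
  have := HasCardinalFilteredColimits.hasColimitsOfShape (κ := κ) W B
  let E : B ⥤ I := (Subtype.mono_coe (· ∈ B)).functor
  refine ⟨Limits.colimit (E ⋙ D), fun i => Limits.colimit.ι (E ⋙ D) i,
    Limits.colimit.desc (E ⋙ D) (c.whisker E), fun i => ?_, fun Z f g h => ?_, fun Z φ hφ => ?_⟩
  · exact Limits.colimit.ι_desc (c.whisker E) i
  · exact Limits.colimit.hom_ext h
  · exact ⟨Limits.colimit.desc (E ⋙ D) ⟨Z, ⟨φ, fun i j f => by
      refine (hφ i j (E.map f)).trans ?_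
      exact (Category.comp_id _).symm⟩⟩, fun i => Limits.colimit.ι_desc _ i⟩

namespace AbstractClass

variable {τ : Vocabulary.{u}} {K : AbstractClass τ}

theorem arrow_eq_of_comp_eq {X Y Z : Arrow K.Model} {f g : X ⟶ Y} (e : Y ⟶ Z)
    (h : f ≫ e = g ≫ e) : f = g := by
  refine Arrow.hom_ext _ _ ?_ ?_
  · exact (cancel_mono e.left).1 (Arrow.hom.congr_left h)
  · exact (cancel_mono e.right).1 (Arrow.hom.congr_right h)

theorem IsMuAEC.exists_arrow_lift {μ : Cardinal.{u}} (hK : K.IsMuAEC μ) {X Y Z : Arrow K.Model}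
    (f : X ⟶ Z) (e : Y ⟶ Z) (h₁ : Set.range (fn f.left) ⊆ Set.range (fn e.left))
    (h₂ : Set.range (fn f.right) ⊆ Set.range (fn e.right)) : ∃ g : X ⟶ Y, g ≫ e = f := by
  obtain ⟨l, hl⟩ := hK.exists_lift _ _ h₁
  obtain ⟨r, hr⟩ := hK.exists_lift _ _ h₂
  refine ⟨Arrow.homMk l r ?_, Arrow.hom_ext _ _ hl hr⟩
  rw [← cancel_mono e.right, Category.assoc, Category.assoc, hr, ← e.w, ← Category.assoc, hl, f.w]

/-- Each small colimit `Y` of generators maps to `f` by an independent square, which is the required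
nonforking once its top map captures `a`. Colimits of independent squares are not known to be
unions, so both the covering of `N` and the size of `Y` are extracted from universal properties and
injectivity. -/
theorem IsMuAEC.rightLocalCharacter_of_rightAccessible {μ : Cardinal.{u}} (hK : K.IsMuAEC μ)
    {R : IndepRel K.Model} (hR : R.Good) (hacc : IndepRel.RightAccessible.{u} R) :
    RightLocalCharacter R := by
  intro α
  obtain ⟨hT, hE, hacc⟩ := hacc
  have := R.nf_isMultiplicative hT hE
  obtain ⟨κ, _, _⟩ := hacc.exists_cardinal
  obtain ⟨P, _, hP⟩ := HasCardinalFilteredGenerator.exists_small_generator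
    (WideSubcategory R.nf) κ
  let σ : Cardinal.{u} := ⨆ X : Subtype P, Cardinal.mk X.1.obj.left
  have hσ : ∀ X, P X → Cardinal.mk X.obj.left ≤ σ := fun X hX =>
    le_ciSup (f := fun X : Subtype P => Cardinal.mk X.1.obj.left) Cardinal.bddAbove_of_small ⟨X, hX⟩
  obtain ⟨b, hb, hμb, hρ⟩ := hK.exists_lstBound (σ + Cardinal.mk α + κ)
  have hσb : σ ≤ b := (self_le_add_right _ _).trans ((self_le_add_right _ _).trans hb)
  have hαb : Cardinal.mk α ≤ b := (self_le_add_left _ _).trans ((self_le_add_right _ _).trans hb)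
  have hκb : κ ≤ b := (self_le_add_left _ _).trans hb
  have hb2 := (Cardinal.cantor b).le
  have hinf : Cardinal.aleph0 ≤ 2 ^ b := (hK.regular.aleph0_le.trans hμb).trans hb2
  refine ⟨2 ^ b, fun M N f a => ?_⟩
  let X : WideSubcategory R.nf := ⟨Arrow.mk f⟩
  obtain ⟨J, _, _, ⟨pJ⟩⟩ := hP.exists_colimitsOfShape X
  obtain ⟨I, _, _, F, _⟩ := IsCardinalFiltered.exists_cardinal_directed J κ
  let p := pJ.reindex F
  have hsub := fun (B : Set I) (hB : IsCardinalFiltered B κ) =>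
    exists_colimit_restrict κ p.diag ⟨X, p.ι⟩ B
  choose Y ι d hd hext hdesc using hsub
  have hfac : ∀ B hB B' hB' (_ : B ⊆ B'), ∃ g : Y B hB ⟶ Y B' hB', g ≫ d B' hB' = d B hB := by
    intro B hB B' hB' h
    obtain ⟨g, hg⟩ := hdesc B hB (Y B' hB') (fun i => ι B' hB' ⟨i.1, h i.2⟩) fun i j k => by
      refine WideSubcategory.hom_ext _ (arrow_eq_of_comp_eq (d B' hB').hom ?_)
      have h₁ := congrArg (fun k => k.hom) (hd B' hB' ⟨j.1, h j.2⟩)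
      have h₂ := congrArg (fun k => k.hom) (hd B' hB' ⟨i.1, h i.2⟩)
      have h₃ := congrArg (fun k => k.hom) (p.w k)
      simp only [WideSubcategory.comp_def] at h₁ h₂ h₃ ⊢
      rw [Category.assoc, h₁, h₂]
      exact h₃
    refine ⟨g, hext B hB _ _ _ fun i => ?_⟩
    rw [← Category.assoc, hg, hd, hd]
  -- The bound `2 ^ b` makes `𝒢` directed for families of size at most `2 ^ b`, in particular for
  -- those of size below `μ`.
  let 𝒢 : Type u := {B : Set I // IsCardinalFiltered B κ ∧ Cardinal.mk B ≤ 2 ^ b}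
  have hsup : ∀ (A : Set I), Cardinal.mk A ≤ 2 ^ b → ∃ G : 𝒢, A ⊆ G.1 := fun A hA => by
    obtain ⟨B, h₁, h₂, h₃⟩ := exists_isCardinalFiltered_superset hκb A hA
    exact ⟨⟨B, h₂, h₃⟩, h₁⟩
  have hsup' : ∀ (T : Type u) (G : T → 𝒢), Cardinal.mk T ≤ 2 ^ b →
      ∃ G' : 𝒢, ∀ t, (G t).1 ⊆ G'.1 := fun T G hT => by
    obtain ⟨G', hG'⟩ := hsup (⋃ t, (G t).1) ((Cardinal.mk_iUnion_le _).trans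
      (Cardinal.mul_le_of_le hinf hT (ciSup_le' fun t => (G t).2.2)))
    exact ⟨G', fun t => (Set.subset_iUnion _ t).trans hG'⟩
  let δ : ∀ G : 𝒢, (Y G.1 G.2.1).obj ⟶ X.obj := fun G => (d G.1 G.2.1).hom
  have hδ : ∀ (G : 𝒢) (i : G.1), (ι G.1 G.2.1 i).hom ≫ δ G = (p.ι.app i.1).hom := fun G i =>
    congrArg (fun k => k.hom) (hd G.1 G.2.1 i)
  have hδl : ∀ G G' : 𝒢, G.1 ⊆ G'.1 →
      Set.range (fn (δ G).left) ⊆ Set.range (fn (δ G').left) := fun G G' h => by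
    obtain ⟨g, hg⟩ := hfac _ G.2.1 _ G'.2.1 h
    have : g.hom ≫ δ G' = δ G := congrArg (fun k => k.hom) hg
    rw [← this]
    exact range_fn_comp_subset _ _
  have hδr : ∀ G G' : 𝒢, G.1 ⊆ G'.1 →
      Set.range (fn (δ G).right) ⊆ Set.range (fn (δ G').right) := fun G G' h => by
    obtain ⟨g, hg⟩ := hfac _ G.2.1 _ G'.2.1 h
    have : g.hom ≫ δ G' = δ G := congrArg (fun k => k.hom) hg
    rw [← this]
    exact range_fn_comp_subset _ _
  have hdir : ∀ {Q : K.Model} (r : 𝒢 → Set Q), (∀ G G' : 𝒢, G.1 ⊆ G'.1 → r G ⊆ r G') →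
      (∀ G, IsStrong Q (r G)) → IsStrong Q (⋃₀ Set.range r) := fun {Q} r hr hr' => by
    refine hK.isStrong_sUnion _ (by rintro _ ⟨G, rfl⟩; exact hr' G) fun T hT hTμ => ?_
    choose G hG using fun P : T => hT P.2
    obtain ⟨G', hG'⟩ := hsup' T G (hTμ.le.trans (hμb.trans hb2))
    refine ⟨_, ⟨G', rfl⟩, fun P hP => ?_⟩
    rw [← show _ = P from hG ⟨P, hP⟩]
    exact hr _ _ (hG' _)
  obtain ⟨M₁, m, hm⟩ := hdir (fun G => Set.range (fn (δ G).left)) hδl fun G => isStrong_range _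
  obtain ⟨N₁, n, hn⟩ := hdir (fun G => Set.range (fn (δ G).right)) hδr fun G => isStrong_range _
  obtain ⟨f', hf'⟩ := hK.exists_lift (m ≫ f) n (by
    rintro _ ⟨x, rfl⟩
    have hx : fn m x ∈ Set.range (fn m) := ⟨x, rfl⟩
    rw [hm] at hx
    obtain ⟨_, ⟨G, rfl⟩, y, hy⟩ := hx
    rw [hn, fn_comp, ← hy]
    exact ⟨_, ⟨G, rfl⟩, fn (Y G.1 G.2.1).obj.hom y, (fn_congr (δ G).w y).symm⟩)
  let e : Arrow.mk f' ⟶ X.obj := Arrow.homMk m n hf'.symm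
  have hψ : ∀ G : 𝒢, ∃ ψ : (Y G.1 G.2.1).obj ⟶ Arrow.mk f', ψ ≫ e = δ G := fun G =>
    hK.exists_arrow_lift (δ G) e
      (by change _ ⊆ Set.range (fn m); rw [hm]; exact Set.subset_sUnion_of_mem ⟨G, rfl⟩)
      (by change _ ⊆ Set.range (fn n); rw [hn]; exact Set.subset_sUnion_of_mem ⟨G, rfl⟩)
  choose ψ hψ using hψ
  have hψnf : ∀ G, R.nf (ψ G) := fun G => hR.nf_of_comp _ e (by
    rw [hψ]
    exact (d G.1 G.2.1).property)
  let X₁ : WideSubcategory R.nf := ⟨Arrow.mk f'⟩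
  have hφ : ∀ i : I, ∃ φ : p.diag.obj i ⟶ X₁, φ.hom ≫ e = (p.ι.app i).hom := fun i => by
    obtain ⟨G, hG⟩ := hsup {i} (by simpa using Cardinal.one_le_aleph0.trans hinf)
    refine ⟨ι G.1 G.2.1 ⟨i, hG rfl⟩ ≫ (⟨ψ G, hψnf G⟩ : Y G.1 G.2.1 ⟶ X₁), ?_⟩
    rw [WideSubcategory.comp_def, Category.assoc]
    exact (congrArg _ (hψ G)).trans (hδ G ⟨i, hG rfl⟩)
  choose φ hφ using hφ
  let c₁ : Limits.Cocone p.diag := ⟨X₁, ⟨φ, fun i j k => by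
    refine Eq.trans ?_ (Category.comp_id _).symm
    refine WideSubcategory.hom_ext _ (arrow_eq_of_comp_eq e ?_)
    rw [WideSubcategory.comp_def, Category.assoc, hφ]
    exact (congrArg (fun k => k.hom) (p.w k)).trans (hφ i).symm⟩⟩
  -- The union `f'` of the images receives the whole diagram, as `nf_of_comp` does not ask that `e`
  -- be independent; hence the colimit maps back into it.
  let u : X ⟶ X₁ := p.isColimit.desc c₁
  have hu : ∀ i, p.ι.app i ≫ u = φ i := p.isColimit.fac c₁
  have hδu : ∀ G, δ G ≫ u.hom = ψ G := fun G => by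
    have : d G.1 G.2.1 ≫ u = (⟨ψ G, hψnf G⟩ : Y G.1 G.2.1 ⟶ X₁) := by
      refine hext G.1 G.2.1 _ _ _ fun i => ?_
      rw [← Category.assoc, hd]
      refine (hu i).trans (WideSubcategory.hom_ext _ (arrow_eq_of_comp_eq e ?_))
      rw [hφ, WideSubcategory.comp_def, Category.assoc]
      exact (hδ G i).symm.trans (congrArg _ (hψ G).symm)
    exact congrArg (fun k => k.hom) this
  -- The element `u y` of the union comes from some `z` in a small colimit, so `u` sends `y` and the
  -- image of `z` to the same point; injectivity of `u` concludes.
  have hsurj : ∀ y : N, ∃ G, y ∈ Set.range (fn (δ G).right) := fun y => by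
    let x : N₁ := fn u.hom.right y
    have hx : fn n x ∈ Set.range (fn n) := ⟨x, rfl⟩
    rw [hn] at hx
    obtain ⟨_, ⟨G, rfl⟩, z, hz⟩ := hx
    refine ⟨G, z, fn_injective u.hom.right ?_⟩
    have h₁ : fn u.hom.right (fn (δ G).right z) = fn (ψ G).right z :=
      fn_congr (Arrow.hom.congr_right (hδu G)) z
    have h₂ : fn n (fn (ψ G).right z) = fn (δ G).right z :=
      fn_congr (Arrow.hom.congr_right (hψ G)) z
    exact h₁.trans (fn_injective n (h₂.trans hz))
  choose Ga hGa using fun x => hsurj (a x)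
  obtain ⟨G, hG⟩ := hsup' α Ga (hαb.trans hb2)
  refine ⟨(Y G.1 G.2.1).obj.left, (δ G).left, ?_, (Y G.1 G.2.1).obj.right, M, N,
    (Y G.1 G.2.1).obj.hom, (δ G).left, (δ G).right, f, 𝟙 N, (d G.1 G.2.1).property, ?_, ?_, ?_⟩
  -- Shrink only the domain: `Q` is a hull of the images of the generators' domains. The diagram
  -- factors through `Q → Y.right`, so the universal property embeds the domain of `Y` in `Q`.
  · obtain ⟨Q, g, hAg, hQ⟩ := hρ (Y G.1 G.2.1).obj.left
      (⋃ i : G.1, Set.range (fn (ι G.1 G.2.1 i).hom.left)) ((Cardinal.mk_iUnion_le _).trans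
        (Cardinal.mul_le_of_le hinf G.2.2 (ciSup_le' fun i =>
          Cardinal.mk_range_le.trans ((hσ _ (p.prop_diag_obj i)).trans (hσb.trans hb2)))))
    let X₂ : WideSubcategory R.nf := ⟨Arrow.mk (g ≫ (Y G.1 G.2.1).obj.hom)⟩
    let e₂ : X₂.obj ⟶ (Y G.1 G.2.1).obj := Arrow.homMk g (𝟙 _) (Category.comp_id _).symm
    have hχ : ∀ i : G.1, ∃ χ : p.diag.obj i ⟶ X₂, χ.hom ≫ e₂ = (ι G.1 G.2.1 i).hom := fun i => by
      obtain ⟨χ, hχ⟩ := hK.exists_arrow_lift (ι G.1 G.2.1 i).hom e₂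
        ((Set.subset_iUnion (fun i : G.1 => Set.range (fn (ι G.1 G.2.1 i).hom.left)) i).trans hAg)
        (fun x _ => ⟨x, rfl⟩)
      exact ⟨⟨χ, hR.nf_of_comp _ e₂ (by rw [hχ]; exact (ι G.1 G.2.1 i).property)⟩, hχ⟩
    choose χ hχ using hχ
    obtain ⟨w, -⟩ := hdesc G.1 G.2.1 X₂ χ fun i j k => by
      refine WideSubcategory.hom_ext _ (arrow_eq_of_comp_eq (e₂ ≫ δ G) ?_)
      rw [WideSubcategory.comp_def, Category.assoc, ← Category.assoc _ e₂, hχ, hδ,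
        ← Category.assoc, hχ, hδ]
      exact congrArg (fun k => k.hom) (p.w k)
    exact (Cardinal.mk_le_of_injective (fn_injective w.hom.left)).trans hQ
  · rw [Category.comp_id]
    exact (δ G).w.symm
  · rintro _ ⟨_, ⟨x, rfl⟩, rfl⟩
    exact hδr _ _ (hG x) (hGa x)
  · rintro _ ⟨_, ⟨x, rfl⟩, rfl⟩
    exact ⟨x, rfl⟩

/-- A stable independence relation has right local character. -/
theorem IsMuAEC.rightLocalCharacter_of_stable {μ : Cardinal.{u}} (hK : K.IsMuAEC μ)
    {R : IndepRel K.Model} (hR : IndepRel.Stable.{u} R) : RightLocalCharacter R :=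
  hK.rightLocalCharacter_of_rightAccessible ⟨hR.transitive, hR.existence, hR.uniqueness⟩
    hR.accessible.2

end AbstractClass

end MuAEC

theorem mainTheorem5 {τ : MuAEC.Vocabulary.{u}} (K : MuAEC.AbstractClass τ) (μ : Cardinal.{u})
    (hK : K.IsMuAEC μ) :
    (∀ R : MuAEC.IndepRel K.Model, R.Invariant → R.Transitive → R.Existence → R.Uniqueness →
      MuAEC.AbstractClass.RightLocalCharacter R →
      (K.HasChainBounds ∨ R.Symmetric) → ¬ K.OrderProperty) ∧
    ((∃ R : MuAEC.IndepRel K.Model, MuAEC.IndepRel.Stable.{u} R) → ¬ K.OrderProperty) := by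
  refine ⟨fun R _ hT hE hU hL h => ?_, fun ⟨R, hR⟩ => ?_⟩
  · rcases h with h | h
    · exact hK.not_orderProperty_of_hasChainBounds ⟨hT, hE, hU⟩ hL h
    · exact hK.not_orderProperty_of_symmetric ⟨hT, hE, hU⟩ hL h
  · exact hK.not_orderProperty_of_symmetric ⟨hR.transitive, hR.existence, hR.uniqueness⟩
      (hK.rightLocalCharacter_of_stable hR) hR.symmetric
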